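/- Let $G$ be a finite group. Write $\bar{\mathcal A}_G$ for the category whose objects are the finite $G$-sets and whose morphisms from $X$ to $Y$ are the isomorphism classes of spans $(X\xleftarrow{p}A\xrightarrow{q}Y)$ of finite $G$-sets, composed by pullback. Write $\bar{\mathcal U}_G$ for the category with the same objects whose morphisms from $X$ to $Y$ are the isomorphism classes of bispans $(X\xleftarrow{p}A\xrightarrow{q}B\xrightarrow{r}Y)$ of finite $G$-sets. The composite of $(X_0\xleftarrow{p_0}A_0\xrightarrow{q_0}B_0\xrightarrow{r_0}X_1)$ followed by $(X_1\xleftarrow{p_1}A_1\xrightarrow{q_1}B_1\xrightarrow{r_1}X_2)$ is $(X_0\xleftarrow{p}A\xrightarrow{q}B\xrightarrow{r}X_2)$, where $B=\{(b_1,s): b_1\in B_1,\ s\colon q_1^{-1}\{b_1\}\to B_0,\ r_0s=p_1\}$, $A=\{(a_0,a_1,s): a_0\in A_0,\ a_1\in A_1,\ s\colon q_1^{-1}\{q_1(a_1)\}\to B_0,\ r_0s=p_1,\ q_0(a_0)=s(a_1)\}$, $p(a_0,a_1,s)=p_0(a_0)$, $q(a_0,a_1,s)=(q_1(a_1),s)$,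 $r(b_1,s)=r_1(b_1)$; the maps $s$ need not be equivariant and $G$ acts on them by conjugation. A *Mackey functor* is a product-preserving functor $\bar{\mathcal A}_G\to\mathrm{Sets}$, and a *Tambara functor* is a product-preserving functor $\bar{\mathcal U}_G\to\mathrm{Sets}$; morphisms are natural transformations, and the categories are $\mathrm{Mackey}_G$ and $\mathrm{Tambara}_G$. For an equivariant map $f\colon X\to Y$ let $T_f$ and $R_f$ be the operations of a Mackey functor given by the spans $(X\xleftarrow{1}X\xrightarrow{f}Y)$ and $(Y\xleftarrow{f}X\xrightarrow{1}X)$, and let $T_f,N_f,R_f$ be the operations of a Tambara functor given by the bispans $(X\xleftarrow{1}X\xrightarrow{1}X\xrightarrow{f}Y)$, $(X\xleftarrow{1}X\xrightarrow{f}Y\xrightarrow{1}Y)$ and $(Y\xleftarrow{f}X\xrightarrow{1}X\xrightarrow{1}X)$. The functor $U\colon\mathrm{Tambara}_G\to\mathrm{Mackey}_G$ sends $S$ to its underlying multiplicative Mackey functor: $US(X)=S(X)$, $R^{US}_f=R^S_f$ and $T^{US}_f=N^S_f$. For equivariant maps $X\xrightarrow{g}Y\xrightarrow{h}Z$ the *distributor*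 $\Delta(g,h)=(X\xleftarrow{p}A\xrightarrow{q}B\xrightarrow{r}Z)$ is given by $B=\{(z,s): z\in Z,\ s\colon h^{-1}\{z\}\to X,\ gs=1\}$, $A=Y\times_Z B$, $p(y,s)=s(y)$, $q(y,s)=(h(y),s)$, $r(z,s)=z$. For a Mackey functor $M$ and a finite $G$-set $X$, let $A[M](X)$ be the set of isomorphism classes $[U,u,m]$ of triples consisting of a finite $G$-set $U$, an equivariant map $u\colon U\to X$ and an element $m\in M(U)$; an isomorphism $(U,u,m)\to(U',u',m')$ is an equivariant bijection $e\colon U\to U'$ with $u'e=u$ and $R_e(m')=m$. Then the following hold. 1. For every Mackey functor $M$ the operations $$T_g[U,u,m]=[U,gu,m],\qquad N_g[U,u,m]=[B,r,T_qR_p(m)],\qquad R_f[U,u,m]=[U\times_XW,\tilde u,R_{\tilde f}(m)]$$ for equivariant $g\colon X\to Y$ and $f\colon W\to X$ are well defined and make $A[M]$ into a Tambara functor; here $\Delta(u,g)=(U\xleftarrow{p}A\xrightarrow{q}B\xrightarrow{r}Y)$, and $\tilde u\colon U\times_XW\to W$ and $\tilde f\colon U\times_XW\to U$ are the projections. 2.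 The construction $M\mapsto A[M]$ is a functor $A[-]\colon\mathrm{Mackey}_G\to\mathrm{Tambara}_G$, where a morphism $\phi\colon M\to M'$ induces $[U,u,m]\mapsto[U,u,\phi(m)]$. 3. The maps $\eta\colon M(X)\to UA[M](X)$, $\eta(m)=[X,1,m]$, and $\epsilon\colon A[US](X)\to S(X)$, $\epsilon[W,f,m]=T_f(m)$, are well defined, are morphisms of Mackey functors and of Tambara functors respectively, are natural in $M$ and in $S$, and satisfy the triangular identities. Hence $A[-]$ is left adjoint to $U$, with unit $\eta$ and counit $\epsilon$. -/

import Mathlib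

universe u w

open CategoryTheory CategoryTheory.Limits

noncomputable section

/-! ## Finite `G`-sets -/

/-- A finite `G`-set. The morphisms are Mathlib's equivariant maps `X →[G] Y`. -/
structure FinGSet (G : Type u) [Group G] : Type (u + 1) where
  carrier : Type u
  [action : MulAction G carrier]
  [finite : Finite carrier]

namespace FinGSet

variable {G : Type u} [Group G]

instance : CoeSort (FinGSet G) (Type u) := ⟨FinGSet.carrier⟩

instance (X : FinGSet G) : MulAction G X := X.action

instance (X : FinGSet G) : Finite X := X.finite

/-- The empty `G`-set. -/
def empty (G : Type u) [Group G] : FinGSet G where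
  carrier := PEmpty
  action :=
    { smul := fun _ x => x
      one_smul := fun x => x.elim
      mul_smul := fun _ _ x => x.elim }

/-- The disjoint union of two finite `G`-sets. -/
abbrev sum (X Y : FinGSet G) : FinGSet G where
  carrier := X ⊕ Y

/-- The inclusion of the left summand. -/
def inl (X Y : FinGSet G) : X →[G] X.sum Y where
  toFun := Sum.inl
  map_smul' _ _ := rfl

/-- The inclusion of the right summand. -/
def inr (X Y : FinGSet G) : Y →[G] X.sum Y where
  toFun := Sum.inr
  map_smul' _ _ := rfl

/-- The map out of a disjoint union with given restrictions to the two summands. -/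
def sumElim {X Y Z : FinGSet G} (f : X →[G] Z) (g : Y →[G] Z) : X.sum Y →[G] Z where
  toFun := Sum.elim f g
  map_smul' := by
    rintro a (x | x)
    · exact map_smul f a x
    · exact map_smul g a x

/-- The disjoint union of two equivariant maps. -/
def sumMap {X Y X' Y' : FinGSet G} (f : X →[G] X') (g : Y →[G] Y') :
    X.sum Y →[G] X'.sum Y' :=
  sumElim ((inl X' Y').comp f) ((inr X' Y').comp g)

/-- The set of pairs `(x, y)` with `f x = g y`. -/
@[ext]
structure Pullback {X Y Z : FinGSet G} (f : X →[G] Z) (g : Y →[G] Z) : Type u where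
  fst : X
  snd : Y
  w : f fst = g snd

instance {X Y Z : FinGSet G} (f : X →[G] Z) (g : Y →[G] Z) : Finite (Pullback f g) :=
  Finite.of_injective (fun t => (t.fst, t.snd)) fun _ _ h =>
    Pullback.ext (congrArg Prod.fst h) (congrArg Prod.snd h)

/-- The diagonal action. -/
instance {X Y Z : FinGSet G} (f : X →[G] Z) (g : Y →[G] Z) : MulAction G (Pullback f g) where
  smul a t := ⟨a • t.fst, a • t.snd, by rw [map_smul, map_smul, t.w]⟩
  one_smul t := Pullback.ext (one_smul G t.fst) (one_smul G t.snd)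
  mul_smul a b t := Pullback.ext (mul_smul a b t.fst) (mul_smul a b t.snd)

/-- The pullback `{(x, y) | f x = g y}` as a finite `G`-set. -/
abbrev pullback {X Y Z : FinGSet G} (f : X →[G] Z) (g : Y →[G] Z) : FinGSet G where
  carrier := Pullback f g

/-- The first projection from a pullback. -/
def pullback.fst {X Y Z : FinGSet G} (f : X →[G] Z) (g : Y →[G] Z) : pullback f g →[G] X where
  toFun t := t.fst
  map_smul' _ _ := rfl

/-- The second projection from a pullback. -/
def pullback.snd {X Y Z : FinGSet G} (f : X →[G] Z) (g : Y →[G] Z) : pullback f g →[G] Y where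
  toFun t := t.snd
  map_smul' _ _ := rfl

/-- Given maps `X ⟵p A ⟶q B` and `r : C ⟶ X`, an element of `Sec p q r` is a pair `(b, s)`
where `b ∈ B` and `s : q⁻¹{b} → C` satisfies `r ∘ s = p` on `q⁻¹{b}`. The map `s` is not required
to be equivariant. -/
structure Sec {A B C X : FinGSet G} (p : A →[G] X) (q : A →[G] B) (r : C →[G] X) : Type u where
  base : B
  sec : ∀ a : A, q a = base → C
  spec : ∀ (a : A) (h : q a = base), r (sec a h) = p a

namespace Sec

variable {A B C X : FinGSet G} {p : A →[G] X} {q : A →[G] B} {r : C →[G] X}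

theorem ext' {x y : Sec p q r} (h : x.base = y.base)
    (hs : ∀ (a : A) (h₁ : q a = x.base) (h₂ : q a = y.base), x.sec a h₁ = y.sec a h₂) :
    x = y := by
  obtain ⟨b, s, hx⟩ := x
  obtain ⟨b', s', hy⟩ := y
  obtain rfl : b = b' := h
  obtain rfl : s = s' := by
    funext a ha
    exact hs a ha ha
  rfl

theorem sec_congr {x y : Sec p q r} (h : x = y) {a a' : A} (haa : a = a') (h₁ : q a = x.base)
    (h₂ : q a' = y.base) : x.sec a h₁ = y.sec a' h₂ := by
  subst h
  subst haa
  rfl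

instance : Finite (Sec p q r) := by
  refine Finite.of_injective
    (β := Σ b : B, ∀ a : A, q a = b → C) (fun x => ⟨x.base, x.sec⟩) ?_
  rintro ⟨b, s, hx⟩ ⟨b', s', hy⟩ h
  obtain ⟨rfl, h⟩ := Sigma.mk.inj h
  obtain rfl := eq_of_heq h
  rfl

/-- `G` acts by `g • (b, s) = (g • b, g s g⁻¹)`. -/
instance : SMul G (Sec p q r) where
  smul g x :=
    { base := g • x.base
      sec := fun a h => g • x.sec (g⁻¹ • a) (by rw [map_smul, h, inv_smul_smul])
      spec := fun a h => by rw [map_smul, x.spec, map_smul, smul_inv_smul] }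

theorem smul_base (g : G) (x : Sec p q r) : (g • x).base = g • x.base := rfl

theorem smul_sec (g : G) (x : Sec p q r) (a : A) (h : q a = (g • x).base) :
    (g • x).sec a h = g • x.sec (g⁻¹ • a) (by rw [map_smul, h, smul_base, inv_smul_smul]) := rfl

instance : MulAction G (Sec p q r) where
  one_smul x := ext' (one_smul G x.base) fun a h₁ h₂ => by
    rw [smul_sec, one_smul]
    exact sec_congr rfl (by rw [inv_one, one_smul]) _ _
  mul_smul g g' x := ext' (mul_smul g g' x.base) fun a h₁ h₂ => by
    rw [smul_sec, smul_sec, smul_sec, mul_smul]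
    exact congrArg _ (congrArg _ (sec_congr rfl (by rw [mul_inv_rev, mul_smul]) _ _))

end Sec

/-- The finite `G`-set of pairs `(b, s)` with `b ∈ B`, `s : q⁻¹{b} → C` and `r s = p`. -/
abbrev secs {A B C X : FinGSet G} (p : A →[G] X) (q : A →[G] B) (r : C →[G] X) : FinGSet G where
  carrier := Sec p q r

/-- The projection `(b, s) ↦ b`. -/
def secs.base {A B C X : FinGSet G} (p : A →[G] X) (q : A →[G] B) (r : C →[G] X) :
    secs p q r →[G] B where
  toFun x := x.base
  map_smul' _ _ := rfl

/-- The evaluation map `(a, (b, s)) ↦ s a`, defined on the pairs with `q a = b`. -/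
def secs.eval {A B C X : FinGSet G} (p : A →[G] X) (q : A →[G] B) (r : C →[G] X) :
    pullback q (secs.base p q r) →[G] C where
  toFun t := t.snd.sec t.fst t.w
  map_smul' g t :=
    congrArg (g • ·) (Sec.sec_congr (x := t.snd) rfl (inv_smul_smul g t.fst) _ _)

end FinGSet

/-! ## Bispans -/

/-- A bispan `X ⟵p A ⟶q B ⟶r Y` of finite `G`-sets. -/
structure GBispan {G : Type u} [Group G] (X Y : FinGSet G) : Type (u + 1) where
  A : FinGSet G
  B : FinGSet G
  p : A →[G] X
  q : A →[G] B
  r : B →[G] Y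

namespace GBispan

variable {G : Type u} [Group G]

/-- Two bispans are isomorphic if there are equivariant bijections `A ≃ A'` and `B ≃ B'` that are
compatible with all the structure maps. -/
def IsIso {X Y : FinGSet G} (ω ω' : GBispan X Y) : Prop :=
  ∃ (α : ω.A ≃ ω'.A) (β : ω.B ≃ ω'.B),
    (∀ (g : G) (a : ω.A), α (g • a) = g • α a) ∧ (∀ (g : G) (b : ω.B), β (g • b) = g • β b) ∧
    (∀ a, ω'.p (α a) = ω.p a) ∧ (∀ a, ω'.q (α a) = β (ω.q a)) ∧ (∀ b, ω'.r (β b) = ω.r b)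

theorem isIso_equivalence (X Y : FinGSet G) : Equivalence (IsIso (X := X) (Y := Y)) where
  refl ω := ⟨Equiv.refl _, Equiv.refl _, by simp⟩
  symm := by
    rintro ω ω' ⟨α, β, hα, hβ, hp, hq, hr⟩
    refine ⟨α.symm, β.symm, fun g a => ?_, fun g b => ?_, fun a => ?_, fun a => ?_, fun b => ?_⟩
    · rw [Equiv.symm_apply_eq, hα, Equiv.apply_symm_apply]
    · rw [Equiv.symm_apply_eq, hβ, Equiv.apply_symm_apply]
    · rw [← hp, Equiv.apply_symm_apply]
    · rw [Equiv.eq_symm_apply, ← hq, Equiv.apply_symm_apply]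
    · rw [← hr, Equiv.apply_symm_apply]
  trans := by
    rintro ω ω' ω'' ⟨α, β, hα, hβ, hp, hq, hr⟩ ⟨α', β', hα', hβ', hp', hq', hr'⟩
    exact ⟨α.trans α', β.trans β', by simp [hα, hα'], by simp [hβ, hβ'], by simp [hp, hp'],
      by simp [hq, hq'], by simp [hr, hr']⟩

instance setoid (X Y : FinGSet G) : Setoid (GBispan X Y) := ⟨IsIso, isIso_equivalence X Y⟩

/-- The bispan `T_f = (X ⟵1 X ⟶1 X ⟶f Y)`. -/
abbrev T {X Y : FinGSet G} (f : X →[G] Y) : GBispan X Y := ⟨X, X, .id G, .id G, f⟩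

/-- The bispan `N_f = (X ⟵1 X ⟶f Y ⟶1 Y)`. -/
abbrev N {X Y : FinGSet G} (f : X →[G] Y) : GBispan X Y := ⟨X, Y, .id G, f, .id G⟩

/-- The bispan `R_f = (Y ⟵f X ⟶1 X ⟶1 X)`. -/
abbrev R {X Y : FinGSet G} (f : X →[G] Y) : GBispan Y X := ⟨X, X, f, .id G, .id G⟩

/-- The identity bispan. -/
abbrev one (X : FinGSet G) : GBispan X X := ⟨X, X, .id G, .id G, .id G⟩

/-- The distributor `Δ(g, h) = (X ⟵p A ⟶q B ⟶r Z)` of `X ⟶g Y ⟶h Z`: here `B` is the set of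
pairs `(z, s)` with `z ∈ Z` and `s : h⁻¹{z} → X` a section of `g` over `h⁻¹{z}`, next
`A = Y ×_Z B`, and `p (y, (z, s)) = s y`, `q (y, (z, s)) = (z, s)`, `r (z, s) = z`. -/
abbrev distributor {X Y Z : FinGSet G} (g : X →[G] Y) (h : Y →[G] Z) : GBispan X Z where
  A := FinGSet.pullback h (FinGSet.secs.base (.id G) h g)
  B := FinGSet.secs (.id G) h g
  p := FinGSet.secs.eval (.id G) h g
  q := FinGSet.pullback.snd h (FinGSet.secs.base (.id G) h g)
  r := FinGSet.secs.base (.id G) h g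

/-- The composite (first `ω₀`, then `ω₁`) of bispans `ω₀ = (X₀ ⟵p₀ A₀ ⟶q₀ B₀ ⟶r₀ X₁)` and
`ω₁ = (X₁ ⟵p₁ A₁ ⟶q₁ B₁ ⟶r₁ X₂)`. It is `(X₀ ⟵p A ⟶q B ⟶r X₂)` where `B` is the set of pairs
`(b₁, s)` with `s : q₁⁻¹{b₁} → B₀` and `r₀ s = p₁`, and `A` is the set of `(a₀, (a₁, (b₁, s)))`
with `(b₁, s) ∈ B`, `q₁ a₁ = b₁` and `q₀ a₀ = s a₁`; moreover `p (a₀, (a₁, (b₁, s))) = p₀ a₀`,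
`q (a₀, (a₁, (b₁, s))) = (b₁, s)` and `r (b₁, s) = r₁ b₁`. -/
abbrev comp {X₀ X₁ X₂ : FinGSet G} (ω₀ : GBispan X₀ X₁) (ω₁ : GBispan X₁ X₂) : GBispan X₀ X₂ where
  A := FinGSet.pullback ω₀.q (FinGSet.secs.eval ω₁.p ω₁.q ω₀.r)
  B := FinGSet.secs ω₁.p ω₁.q ω₀.r
  p := ω₀.p.comp (FinGSet.pullback.fst ω₀.q (FinGSet.secs.eval ω₁.p ω₁.q ω₀.r))
  q := (FinGSet.pullback.snd ω₁.q (FinGSet.secs.base ω₁.p ω₁.q ω₀.r)).comp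
    (FinGSet.pullback.snd ω₀.q (FinGSet.secs.eval ω₁.p ω₁.q ω₀.r))
  r := ω₁.r.comp (FinGSet.secs.base ω₁.p ω₁.q ω₀.r)

open FinGSet


section

variable {X₀ X₁ X₂ : FinGSet G}

/-- The right middle set of a composite of bispans. -/
abbrev CompB (ω₀ : GBispan X₀ X₁) (ω₁ : GBispan X₁ X₂) : Type u :=
  FinGSet.Sec ω₁.p ω₁.q ω₀.r

/-- The left middle set of a composite of bispans. -/
abbrev CompA (ω₀ : GBispan X₀ X₁) (ω₁ : GBispan X₁ X₂) : Type u :=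
  FinGSet.Pullback ω₀.q (FinGSet.secs.eval ω₁.p ω₁.q ω₀.r)

theorem compA_ext {ω₀ : GBispan X₀ X₁} {ω₁ : GBispan X₁ X₂} {t t' : CompA ω₀ ω₁}
    (h₀ : t.fst = t'.fst) (h₁ : t.snd.fst = t'.snd.fst) (h₂ : t.snd.snd = t'.snd.snd) : t = t' :=
  FinGSet.Pullback.ext h₀ (FinGSet.Pullback.ext h₁ h₂)

end

theorem one_comp {X Y : FinGSet G} (ω : GBispan X Y) : ((one X).comp ω).IsIso ω := by
  refine ⟨⟨fun t : CompA (one X) ω => t.snd.fst,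
    fun a => (⟨ω.p a, ⟨a, ⟨ω.q a, fun a' _ => ω.p a', fun _ _ => rfl⟩, rfl⟩, rfl⟩ :
      CompA (one X) ω),
    fun t : CompA (one X) ω => ?_, fun a => rfl⟩,
    ⟨fun x : CompB (one X) ω => x.base,
      fun b => (⟨b, fun a' _ => ω.p a', fun _ _ => rfl⟩ : CompB (one X) ω),
      fun x : CompB (one X) ω => ?_, fun b => rfl⟩,
    fun g a => rfl, fun g b => rfl, fun t : CompA (one X) ω => ?_,
    fun t : CompA (one X) ω => t.snd.w, fun b => rfl⟩
  · have h : ∀ (a : ω.A) h, t.snd.snd.sec a h = ω.p a := t.snd.snd.spec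
    refine compA_ext ?_ rfl (FinGSet.Sec.ext' t.snd.w fun a h₁ h₂ => (h _ _).symm)
    exact ((h _ _).symm.trans t.w.symm)
  · exact FinGSet.Sec.ext' rfl fun a h₁ h₂ => (x.spec a h₂).symm
  · exact (t.snd.snd.spec _ _).symm.trans t.w.symm

theorem comp_one {X Y : FinGSet G} (ω : GBispan X Y) : (ω.comp (one Y)).IsIso ω := by
  refine ⟨⟨fun t : CompA ω (one Y) => t.fst,
    fun a => (⟨a, ⟨ω.r (ω.q a), ⟨ω.r (ω.q a), fun _ _ => ω.q a, fun a h => h.symm⟩, rfl⟩, rfl⟩ :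
      CompA ω (one Y)),
    fun t : CompA ω (one Y) => ?_, fun a => rfl⟩,
    ⟨fun x : CompB ω (one Y) => x.sec x.base rfl,
      fun b => (⟨ω.r b, fun _ _ => b, fun a h => h.symm⟩ : CompB ω (one Y)),
      fun x : CompB ω (one Y) => ?_, fun b => rfl⟩,
    fun g t => rfl, fun g (x : CompB ω (one Y)) => ?_, fun t => rfl,
    fun t : CompA ω (one Y) => ?_, fun x : CompB ω (one Y) => x.spec _ _⟩
  · have h : ω.r (ω.q t.fst) = t.snd.fst :=
      (congrArg ω.r t.w).trans (t.snd.snd.spec _ _)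
    have h' : t.snd.fst = t.snd.snd.base := t.snd.w
    refine compA_ext rfl h (FinGSet.Sec.ext' (h.trans h') fun a h₁ h₂ => ?_)
    exact t.w.trans (FinGSet.Sec.sec_congr rfl (h'.trans h₂.symm) _ _)
  · refine FinGSet.Sec.ext' (x.spec _ _) fun a h₁ h₂ => FinGSet.Sec.sec_congr rfl h₂.symm _ _
  · exact congrArg (fun b : ω.B => g • b)
      (FinGSet.Sec.sec_congr (x := x) rfl (inv_smul_smul g x.base) _ _)
  · exact t.w.trans (FinGSet.Sec.sec_congr rfl t.snd.w _ _)

/-- The map on right middle sets induced by a pair of isomorphisms of bispans. -/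
def compMapB {X₀ X₁ X₂ : FinGSet G} {ω₀ ω₀' : GBispan X₀ X₁} {ω₁ ω₁' : GBispan X₁ X₂}
    (β₀ : ω₀.B ≃ ω₀'.B) (α₁ : ω₁.A ≃ ω₁'.A) (β₁ : ω₁.B ≃ ω₁'.B)
    (hr₀ : ∀ b, ω₀'.r (β₀ b) = ω₀.r b) (hp₁ : ∀ a, ω₁'.p (α₁ a) = ω₁.p a)
    (hq₁ : ∀ a, ω₁'.q (α₁ a) = β₁ (ω₁.q a)) (x : CompB ω₀ ω₁) : CompB ω₀' ω₁' where
  base := β₁ x.base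
  sec a h := β₀ (x.sec (α₁.symm a) (β₁.injective (by rw [← hq₁, α₁.apply_symm_apply, h])))
  spec a h := by rw [hr₀, x.spec, ← hp₁, α₁.apply_symm_apply]

theorem compMapB_compMapB {X₀ X₁ X₂ : FinGSet G} {ω₀ ω₀' : GBispan X₀ X₁}
    {ω₁ ω₁' : GBispan X₁ X₂} (β₀ : ω₀.B ≃ ω₀'.B) (α₁ : ω₁.A ≃ ω₁'.A) (β₁ : ω₁.B ≃ ω₁'.B)
    (hr₀ hp₁ hq₁ hr₀' hp₁' hq₁') (x : CompB ω₀ ω₁) :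
    compMapB β₀.symm α₁.symm β₁.symm hr₀' hp₁' hq₁'
      (compMapB (ω₀' := ω₀') (ω₁' := ω₁') β₀ α₁ β₁ hr₀ hp₁ hq₁ x) = x := by
  refine FinGSet.Sec.ext' (β₁.symm_apply_apply _) fun a h₁ h₂ => ?_
  refine (β₀.symm_apply_apply _).trans (FinGSet.Sec.sec_congr rfl ?_ _ _)
  simp

theorem comp_congr {X₀ X₁ X₂ : FinGSet G} {ω₀ ω₀' : GBispan X₀ X₁} {ω₁ ω₁' : GBispan X₁ X₂}
    (h₀ : ω₀.IsIso ω₀') (h₁ : ω₁.IsIso ω₁') : (ω₀.comp ω₁).IsIso (ω₀'.comp ω₁') := by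
  obtain ⟨α₀, β₀, hα₀, hβ₀, hp₀, hq₀, hr₀⟩ := h₀
  obtain ⟨α₁, β₁, hα₁, hβ₁, hp₁, hq₁, hr₁⟩ := h₁
  have hp₀' : ∀ a, ω₀.p (α₀.symm a) = ω₀'.p a := fun a => by rw [← hp₀, α₀.apply_symm_apply]
  have hp₁' : ∀ a, ω₁.p (α₁.symm a) = ω₁'.p a := fun a => by rw [← hp₁, α₁.apply_symm_apply]
  have hr₀' : ∀ b, ω₀.r (β₀.symm b) = ω₀'.r b := fun b => by rw [← hr₀, β₀.apply_symm_apply]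
  have hq₀' : ∀ a, ω₀.q (α₀.symm a) = β₀.symm (ω₀'.q a) := fun a => by
    rw [Equiv.eq_symm_apply, ← hq₀, α₀.apply_symm_apply]
  have hq₁' : ∀ a, ω₁.q (α₁.symm a) = β₁.symm (ω₁'.q a) := fun a => by
    rw [Equiv.eq_symm_apply, ← hq₁, α₁.apply_symm_apply]
  have hα₁' : ∀ (g : G) a, α₁.symm (g • a) = g • α₁.symm a := fun g a => by
    rw [Equiv.symm_apply_eq, hα₁, Equiv.apply_symm_apply]
  let φ := compMapB β₀ α₁ β₁ hr₀ hp₁ hq₁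
  let ψ := compMapB β₀.symm α₁.symm β₁.symm hr₀' hp₁' hq₁'
  have hψφ : ∀ x, ψ (φ x) = x := fun x => compMapB_compMapB _ _ _ _ _ _ _ _ _ _
  have hφψ : ∀ x, φ (ψ x) = x := fun x =>
    compMapB_compMapB β₀.symm α₁.symm β₁.symm hr₀' hp₁' hq₁' hr₀ hp₁ hq₁ x
  have hφ : ∀ (g : G) x, φ (g • x) = g • φ x := fun g x =>
    FinGSet.Sec.ext' (hβ₁ g x.base) fun a h₁ h₂ => by
      refine (hβ₀ g _).trans (congrArg (fun b : ω₀'.B => g • b) (congrArg β₀ ?_))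
      exact FinGSet.Sec.sec_congr rfl (hα₁' _ _).symm _ _
  refine ⟨⟨fun t : CompA ω₀ ω₁ => (⟨α₀ t.fst, ⟨α₁ t.snd.fst, φ t.snd.snd, ?_⟩, ?_⟩ :
      CompA ω₀' ω₁'),
    fun t : CompA ω₀' ω₁' => (⟨α₀.symm t.fst, ⟨α₁.symm t.snd.fst, ψ t.snd.snd, ?_⟩, ?_⟩ :
      CompA ω₀ ω₁), fun t : CompA ω₀ ω₁ => ?_, fun t : CompA ω₀' ω₁' => ?_⟩,
    ⟨φ, ψ, hψφ, hφψ⟩, fun g (t : CompA ω₀ ω₁) => ?_, fun g (x : CompB ω₀ ω₁) => ?_,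
    fun t : CompA ω₀ ω₁ => hp₀ _, fun t => rfl, fun x => hr₁ _⟩
  · exact (hq₁ _).trans (congrArg β₁ t.snd.w)
  · refine (hq₀ _).trans (congrArg β₀ (t.w.trans (FinGSet.Sec.sec_congr rfl ?_ _ _)))
    simp
  · exact (hq₁' _).trans (congrArg β₁.symm t.snd.w)
  · refine (hq₀' _).trans (congrArg β₀.symm (t.w.trans (FinGSet.Sec.sec_congr rfl ?_ _ _)))
    simp
  · exact compA_ext (α₀.symm_apply_apply _) (α₁.symm_apply_apply _) (hψφ _)
  · exact compA_ext (α₀.apply_symm_apply _) (α₁.apply_symm_apply _) (hφψ _)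
  · exact compA_ext (hα₀ g t.fst) (hα₁ g t.snd.fst) (hφ g t.snd.snd)
  · exact hφ g x

section Assoc

variable {X₀ X₁ X₂ X₃ : FinGSet G} {ω₀ : GBispan X₀ X₁} {ω₁ : GBispan X₁ X₂}
  {ω₂ : GBispan X₂ X₃}

/-- The reassociation map on right middle sets. -/
def assocB (x : CompB (ω₀.comp ω₁) ω₂) : CompB ω₀ (ω₁.comp ω₂) where
  base := (⟨x.base, fun a h => FinGSet.Sec.base (x.sec a h), x.spec⟩ : CompB ω₁ ω₂)
  sec (a : CompA ω₁ ω₂) h :=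
    FinGSet.Sec.sec (x.sec a.snd.fst (a.snd.w.trans (congrArg FinGSet.Sec.base h))) a.fst
      (a.w.trans (FinGSet.Sec.sec_congr h rfl _ _))
  spec (a : CompA ω₁ ω₂) _ := FinGSet.Sec.spec (x.sec a.snd.fst _) a.fst _

/-- The inverse of the reassociation map on right middle sets. -/
def assocBInv (y : CompB ω₀ (ω₁.comp ω₂)) : CompB (ω₀.comp ω₁) ω₂ where
  base := FinGSet.Sec.base y.base
  sec a h := (⟨FinGSet.Sec.sec y.base a h,
    fun a' h' => y.sec (⟨a', ⟨a, y.base, h⟩, h'⟩ : CompA ω₁ ω₂) rfl, fun _ _ => y.spec _ _⟩ :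
      CompB ω₀ ω₁)
  spec a h := FinGSet.Sec.spec y.base a h

theorem compA_mk_eq (a : CompA ω₁ ω₂) {x : CompB ω₁ ω₂} (h : a.snd.snd = x) {h₁ h₂} :
    (⟨a.fst, ⟨a.snd.fst, x, h₁⟩, h₂⟩ : CompA ω₁ ω₂) = a := by
  subst h
  rfl

theorem assocBInv_assocB (x : CompB (ω₀.comp ω₁) ω₂) : assocBInv (assocB x) = x :=
  FinGSet.Sec.ext' rfl fun _ _ _ => FinGSet.Sec.ext' rfl fun _ _ _ => rfl

theorem assocB_assocBInv (y : CompB ω₀ (ω₁.comp ω₂)) : assocB (assocBInv y) = y :=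
  FinGSet.Sec.ext' (FinGSet.Sec.ext' rfl fun _ _ _ => rfl) fun (a : CompA ω₁ ω₂) _ h₂ =>
    FinGSet.Sec.sec_congr (x := y) (a := (⟨a.fst, ⟨a.snd.fst, y.base, _⟩, _⟩ : CompA ω₁ ω₂)) rfl
      (compA_mk_eq a h₂) rfl h₂

/-- The reassociation map on left middle sets. -/
def assocA (t : CompA (ω₀.comp ω₁) ω₂) : CompA ω₀ (ω₁.comp ω₂) :=
  have h : FinGSet.Pullback.snd (FinGSet.Pullback.snd t.fst) = t.snd.snd.sec t.snd.fst t.snd.w :=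
    t.w
  ⟨FinGSet.Pullback.fst t.fst,
    ⟨(⟨FinGSet.Pullback.fst (FinGSet.Pullback.snd t.fst),
      ⟨t.snd.fst, (assocB t.snd.snd).base, t.snd.w⟩,
      (FinGSet.Pullback.w (FinGSet.Pullback.snd t.fst)).trans
        (congrArg FinGSet.Sec.base h)⟩ : CompA ω₁ ω₂), assocB t.snd.snd, rfl⟩,
    (FinGSet.Pullback.w t.fst).trans (FinGSet.Sec.sec_congr h rfl _ _)⟩

/-- The inverse of the reassociation map on left middle sets. -/
def assocAInv (t : CompA ω₀ (ω₁.comp ω₂)) : CompA (ω₀.comp ω₁) ω₂ :=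
  have h : FinGSet.Pullback.snd (FinGSet.Pullback.snd t.snd.fst) = t.snd.snd.base := t.snd.w
  have h' : ω₂.q (FinGSet.Pullback.fst (FinGSet.Pullback.snd t.snd.fst)) =
      (assocBInv t.snd.snd).base :=
    (FinGSet.Pullback.w (FinGSet.Pullback.snd t.snd.fst)).trans (congrArg FinGSet.Sec.base h)
  ⟨(⟨t.fst, ⟨FinGSet.Pullback.fst t.snd.fst, (assocBInv t.snd.snd).sec _ h',
      (FinGSet.Pullback.w t.snd.fst).trans (FinGSet.Sec.sec_congr h rfl _ _)⟩,
      t.w.trans (FinGSet.Sec.sec_congr (x := t.snd.snd) rfl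
        (compA_mk_eq t.snd.fst h).symm t.snd.w rfl)⟩ : CompA ω₀ ω₁),
    ⟨FinGSet.Pullback.fst (FinGSet.Pullback.snd t.snd.fst), assocBInv t.snd.snd, h'⟩, rfl⟩

theorem assocAInv_assocA (t : CompA (ω₀.comp ω₁) ω₂) : assocAInv (assocA t) = t := by
  refine compA_ext (compA_ext rfl rfl ?_) rfl (assocBInv_assocB _)
  exact (FinGSet.Sec.sec_congr (assocBInv_assocB t.snd.snd) rfl _ _).trans t.w.symm

theorem assocA_assocAInv (t : CompA ω₀ (ω₁.comp ω₂)) : assocA (assocAInv t) = t := by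
  refine compA_ext rfl (compA_ext rfl rfl ?_) (assocB_assocBInv _)
  exact (congrArg FinGSet.Sec.base (assocB_assocBInv t.snd.snd)).trans t.snd.w.symm

theorem assocB_smul (g : G) (x : CompB (ω₀.comp ω₁) ω₂) : assocB (g • x) = g • assocB x :=
  FinGSet.Sec.ext' (FinGSet.Sec.ext' rfl fun _ _ _ => rfl) fun _ _ _ => rfl

theorem assocA_smul (g : G) (t : CompA (ω₀.comp ω₁) ω₂) : assocA (g • t) = g • assocA t :=
  compA_ext rfl (compA_ext rfl rfl (FinGSet.Sec.ext' rfl fun _ _ _ => rfl)) (assocB_smul g _)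

theorem comp_assoc (ω₀ : GBispan X₀ X₁) (ω₁ : GBispan X₁ X₂) (ω₂ : GBispan X₂ X₃) :
    ((ω₀.comp ω₁).comp ω₂).IsIso (ω₀.comp (ω₁.comp ω₂)) :=
  ⟨⟨fun t : CompA (ω₀.comp ω₁) ω₂ => assocA t,
    fun t : CompA ω₀ (ω₁.comp ω₂) => assocAInv t, assocAInv_assocA, assocA_assocAInv⟩,
    ⟨fun x : CompB (ω₀.comp ω₁) ω₂ => assocB x, fun y : CompB ω₀ (ω₁.comp ω₂) => assocBInv y,
      assocBInv_assocB, assocB_assocBInv⟩,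
    assocA_smul, assocB_smul, fun _ => rfl, fun _ => rfl, fun _ => rfl⟩

end Assoc

end GBispan

/-! ## Spans -/

/-- A span `X ⟵p A ⟶q Y` of finite `G`-sets. -/
structure GSpan {G : Type u} [Group G] (X Y : FinGSet G) : Type (u + 1) where
  A : FinGSet G
  p : A →[G] X
  q : A →[G] Y

namespace GSpan

variable {G : Type u} [Group G]

/-- Two spans are isomorphic if there is an equivariant bijection `A ≃ A'` that is compatible with
the structure maps. -/
def IsIso {X Y : FinGSet G} (σ σ' : GSpan X Y) : Prop :=
  ∃ α : σ.A ≃ σ'.A, (∀ (g : G) (a : σ.A), α (g • a) = g • α a) ∧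
    (∀ a, σ'.p (α a) = σ.p a) ∧ (∀ a, σ'.q (α a) = σ.q a)

theorem isIso_equivalence (X Y : FinGSet G) : Equivalence (IsIso (X := X) (Y := Y)) where
  refl σ := ⟨Equiv.refl _, by simp⟩
  symm := by
    rintro σ σ' ⟨α, hα, hp, hq⟩
    refine ⟨α.symm, fun g a => ?_, fun a => ?_, fun a => ?_⟩
    · rw [Equiv.symm_apply_eq, hα, Equiv.apply_symm_apply]
    · rw [← hp, Equiv.apply_symm_apply]
    · rw [← hq, Equiv.apply_symm_apply]
  trans := by
    rintro σ σ' σ'' ⟨α, hα, hp, hq⟩ ⟨α', hα', hp', hq'⟩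
    exact ⟨α.trans α', by simp [hα, hα'], by simp [hp, hp'], by simp [hq, hq']⟩

instance setoid (X Y : FinGSet G) : Setoid (GSpan X Y) := ⟨IsIso, isIso_equivalence X Y⟩

theorem IsIso.of_bijective {X Y : FinGSet G} {σ σ' : GSpan X Y} (α : σ.A →[G] σ'.A)
    (hα : Function.Bijective α) (hp : ∀ a, σ'.p (α a) = σ.p a) (hq : ∀ a, σ'.q (α a) = σ.q a) :
    σ.IsIso σ' :=
  ⟨Equiv.ofBijective α hα, fun g a => map_smul α g a, hp, hq⟩

/-- The span `T_f = (X ⟵1 X ⟶f Y)`. -/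
abbrev T {X Y : FinGSet G} (f : X →[G] Y) : GSpan X Y := ⟨X, .id G, f⟩

/-- The span `R_f = (Y ⟵f X ⟶1 X)`. -/
abbrev R {X Y : FinGSet G} (f : X →[G] Y) : GSpan Y X := ⟨X, f, .id G⟩

/-- The identity span. -/
abbrev one (X : FinGSet G) : GSpan X X := ⟨X, .id G, .id G⟩

/-- The composite (first `σ₀`, then `σ₁`) of two spans, given by the pullback. -/
abbrev comp {X₀ X₁ X₂ : FinGSet G} (σ₀ : GSpan X₀ X₁) (σ₁ : GSpan X₁ X₂) : GSpan X₀ X₂ where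
  A := FinGSet.pullback σ₀.q σ₁.p
  p := σ₀.p.comp (FinGSet.pullback.fst σ₀.q σ₁.p)
  q := σ₁.q.comp (FinGSet.pullback.snd σ₀.q σ₁.p)

/-- The bispan `X ⟵p A ⟶q Y ⟶1 Y` (representing `N_q R_p`) attached to a span `X ⟵p A ⟶q Y`. -/
abbrev toBispan {X Y : FinGSet G} (σ : GSpan X Y) : GBispan X Y := ⟨σ.A, Y, σ.p, σ.q, .id G⟩

theorem toBispan_isIso_iff {X Y : FinGSet G} {σ σ' : GSpan X Y} :
    σ.toBispan.IsIso σ'.toBispan ↔ σ.IsIso σ' := by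
  constructor
  · rintro ⟨α, β, hα, -, hp, hq, hr⟩
    exact ⟨α, hα, hp, fun a => (hq a).trans (hr _)⟩
  · rintro ⟨α, hα, hp, hq⟩
    exact ⟨α, Equiv.refl _, hα, fun _ _ => rfl, hp, hq, fun _ => rfl⟩

theorem toBispan_comp {X₀ X₁ X₂ : FinGSet G} (σ₀ : GSpan X₀ X₁) (σ₁ : GSpan X₁ X₂) :
    (σ₀.comp σ₁).toBispan.IsIso (σ₀.toBispan.comp σ₁.toBispan) := by
  refine ⟨⟨fun t : FinGSet.Pullback σ₀.q σ₁.p =>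
      (⟨t.fst, ⟨t.snd, ⟨σ₁.q t.snd, fun a _ => σ₁.p a, fun _ _ => rfl⟩, rfl⟩, t.w⟩ :
        GBispan.CompA σ₀.toBispan σ₁.toBispan),
    fun t : GBispan.CompA σ₀.toBispan σ₁.toBispan =>
      (⟨t.fst, t.snd.fst, t.w.trans (t.snd.snd.spec _ _)⟩ : FinGSet.Pullback σ₀.q σ₁.p),
    fun t => rfl, fun t : GBispan.CompA σ₀.toBispan σ₁.toBispan => ?_⟩,
    ⟨fun b => (⟨b, fun a _ => σ₁.p a, fun _ _ => rfl⟩ :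
        GBispan.CompB σ₀.toBispan σ₁.toBispan),
      fun x : GBispan.CompB σ₀.toBispan σ₁.toBispan => x.base, fun b => rfl,
      fun x : GBispan.CompB σ₀.toBispan σ₁.toBispan => ?_⟩,
    fun g t => ?_, fun g b => ?_, fun t => rfl, fun t => rfl, fun b => rfl⟩
  · exact GBispan.compA_ext rfl rfl
      (FinGSet.Sec.ext' t.snd.w fun a h₁ h₂ => (t.snd.snd.spec a h₂).symm)
  · exact FinGSet.Sec.ext' rfl fun a h₁ h₂ => (x.spec a h₂).symm
  · refine GBispan.compA_ext rfl rfl (FinGSet.Sec.ext' (map_smul σ₁.q g _) fun a h₁ h₂ => ?_)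
    exact ((map_smul σ₁.p g _).symm.trans (congrArg σ₁.p (smul_inv_smul g a))).symm
  · refine FinGSet.Sec.ext' rfl fun a h₁ h₂ => ?_
    exact ((map_smul σ₁.p g _).symm.trans (congrArg σ₁.p (smul_inv_smul g a))).symm

theorem comp_congr {X₀ X₁ X₂ : FinGSet G} {σ₀ σ₀' : GSpan X₀ X₁} {σ₁ σ₁' : GSpan X₁ X₂}
    (h₀ : σ₀.IsIso σ₀') (h₁ : σ₁.IsIso σ₁') : (σ₀.comp σ₁).IsIso (σ₀'.comp σ₁') := by
  have E := GBispan.isIso_equivalence X₀ X₂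
  exact toBispan_isIso_iff.1 (E.trans (toBispan_comp _ _) (E.trans
    (GBispan.comp_congr (toBispan_isIso_iff.2 h₀) (toBispan_isIso_iff.2 h₁))
    (E.symm (toBispan_comp _ _))))

theorem one_comp {X Y : FinGSet G} (σ : GSpan X Y) : ((one X).comp σ).IsIso σ :=
  toBispan_isIso_iff.1 ((GBispan.isIso_equivalence X Y).trans (toBispan_comp _ _)
    (GBispan.one_comp _))

theorem comp_one {X Y : FinGSet G} (σ : GSpan X Y) : (σ.comp (one Y)).IsIso σ :=
  toBispan_isIso_iff.1 ((GBispan.isIso_equivalence X Y).trans (toBispan_comp _ _)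
    (GBispan.comp_one _))

theorem comp_assoc {X₀ X₁ X₂ X₃ : FinGSet G} (σ₀ : GSpan X₀ X₁) (σ₁ : GSpan X₁ X₂)
    (σ₂ : GSpan X₂ X₃) : ((σ₀.comp σ₁).comp σ₂).IsIso (σ₀.comp (σ₁.comp σ₂)) := by
  have E := GBispan.isIso_equivalence X₀ X₃
  refine toBispan_isIso_iff.1 (E.trans (E.trans (toBispan_comp _ _)
    (GBispan.comp_congr (toBispan_comp _ _) ((GBispan.isIso_equivalence X₂ X₃).refl _)))
    (E.trans (GBispan.comp_assoc _ _ _) (E.symm (E.trans (toBispan_comp _ _)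
      (GBispan.comp_congr ((GBispan.isIso_equivalence X₀ X₁).refl _) (toBispan_comp _ _))))))

end GSpan

/-! ## The categories of isomorphism classes of spans and of bispans -/

/-- The category with finite `G`-sets as objects and isomorphism classes of spans as morphisms. -/
def SpanCat (G : Type u) [Group G] : Type (u + 1) := FinGSet G

/-- The category with finite `G`-sets as objects and isomorphism classes of bispans as
morphisms. -/
def BispanCat (G : Type u) [Group G] : Type (u + 1) := FinGSet G

section Categories

variable {G : Type u} [Group G]

instance : Category.{u + 1} (SpanCat G) where
  Hom X Y := Quotient (GSpan.setoid (G := G) X Y)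
  id X := ⟦GSpan.one X⟧
  comp := Quotient.map₂ GSpan.comp fun _ _ h₀ _ _ h₁ => GSpan.comp_congr h₀ h₁
  id_comp := by
    rintro X Y ⟨σ⟩
    exact Quotient.sound (GSpan.one_comp σ)
  comp_id := by
    rintro X Y ⟨σ⟩
    exact Quotient.sound (GSpan.comp_one σ)
  assoc := by
    rintro X₀ X₁ X₂ X₃ ⟨σ₀⟩ ⟨σ₁⟩ ⟨σ₂⟩
    exact Quotient.sound (GSpan.comp_assoc σ₀ σ₁ σ₂)

instance : Category.{u + 1} (BispanCat G) where
  Hom X Y := Quotient (GBispan.setoid (G := G) X Y)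
  id X := ⟦GBispan.one X⟧
  comp := Quotient.map₂ GBispan.comp fun _ _ h₀ _ _ h₁ => GBispan.comp_congr h₀ h₁
  id_comp := by
    rintro X Y ⟨ω⟩
    exact Quotient.sound (GBispan.one_comp ω)
  comp_id := by
    rintro X Y ⟨ω⟩
    exact Quotient.sound (GBispan.comp_one ω)
  assoc := by
    rintro X₀ X₁ X₂ X₃ ⟨ω₀⟩ ⟨ω₁⟩ ⟨ω₂⟩
    exact Quotient.sound (GBispan.comp_assoc ω₀ ω₁ ω₂)

/-- A finite `G`-set as an object of the span category. -/
def SpanCat.of (X : FinGSet G) : SpanCat G := X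

/-- A finite `G`-set as an object of the bispan category. -/
def BispanCat.of (X : FinGSet G) : BispanCat G := X

/-- The morphism represented by a span. -/
def GSpan.hom {X Y : FinGSet G} (σ : GSpan X Y) : SpanCat.of X ⟶ SpanCat.of Y :=
  Quotient.mk (GSpan.setoid X Y) σ

/-- The morphism represented by a bispan. -/
def GBispan.hom {X Y : FinGSet G} (ω : GBispan X Y) : BispanCat.of X ⟶ BispanCat.of Y :=
  Quotient.mk (GBispan.setoid X Y) ω

/-- The functor from spans to bispans, which is the identity on objects and sends the class of
`X ⟵p A ⟶q Y` to the class of `X ⟵p A ⟶q Y ⟶1 Y`. In particular `R_f ↦ R_f` and `T_f ↦ N_f`. -/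
def spanToBispan (G : Type u) [Group G] : SpanCat G ⥤ BispanCat G where
  obj X := BispanCat.of X
  map := Quotient.map GSpan.toBispan fun _ _ h => GSpan.toBispan_isIso_iff.2 h
  map_id _ := rfl
  map_comp := by
    rintro X₀ X₁ X₂ ⟨σ₀⟩ ⟨σ₁⟩
    exact Quotient.sound (GSpan.toBispan_comp σ₀ σ₁)

theorem spanToBispan_map_R {X Y : FinGSet G} (f : X →[G] Y) :
    (spanToBispan G).map (GSpan.R f).hom = (GBispan.R f).hom := rfl

theorem spanToBispan_map_T {X Y : FinGSet G} (f : X →[G] Y) :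
    (spanToBispan G).map (GSpan.T f).hom = (GBispan.N f).hom := rfl

end Categories

/-! ## Finite products of finite `G`-sets in these categories -/

section Products

variable {G : Type u} [Group G]

theorem GBispan.IsIso.of_bijective {X Y : FinGSet G} {ω ω' : GBispan X Y} (α : ω.A →[G] ω'.A)
    (β : ω.B →[G] ω'.B) (hα : Function.Bijective α) (hβ : Function.Bijective β)
    (hp : ∀ a, ω'.p (α a) = ω.p a) (hq : ∀ a, ω'.q (α a) = β (ω.q a))
    (hr : ∀ b, ω'.r (β b) = ω.r b) : ω.IsIso ω' :=
  ⟨Equiv.ofBijective α hα, Equiv.ofBijective β hβ, fun g a => map_smul α g a,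
    fun g b => map_smul β g b, hp, hq, hr⟩

/-- The span into a disjoint union with given components. -/
abbrev GSpan.pair {Z X Y : FinGSet G} (σ : GSpan Z X) (τ : GSpan Z Y) : GSpan Z (X.sum Y) where
  A := σ.A.sum τ.A
  p := FinGSet.sumElim σ.p τ.p
  q := FinGSet.sumMap σ.q τ.q

/-- The bispan into a disjoint union with given components. -/
abbrev GBispan.pair {Z X Y : FinGSet G} (σ : GBispan Z X) (τ : GBispan Z Y) :
    GBispan Z (X.sum Y) where
  A := σ.A.sum τ.A
  B := σ.B.sum τ.B
  p := FinGSet.sumElim σ.p τ.p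
  q := FinGSet.sumMap σ.q τ.q
  r := FinGSet.sumMap σ.r τ.r

theorem GSpan.pair_congr {Z X Y : FinGSet G} {σ σ' : GSpan Z X} {τ τ' : GSpan Z Y}
    (hσ : σ.IsIso σ') (hτ : τ.IsIso τ') : (σ.pair τ).IsIso (σ'.pair τ') := by
  obtain ⟨α, hα, hp, hq⟩ := hσ
  obtain ⟨α', hα', hp', hq'⟩ := hτ
  refine ⟨Equiv.sumCongr α α', ?_, ?_, ?_⟩
  · rintro g (a | a)
    · exact congrArg Sum.inl (hα g a)
    · exact congrArg Sum.inr (hα' g a)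
  · rintro (a | a)
    · exact hp a
    · exact hp' a
  · rintro (a | a)
    · exact congrArg Sum.inl (hq a)
    · exact congrArg Sum.inr (hq' a)

theorem GBispan.pair_congr {Z X Y : FinGSet G} {σ σ' : GBispan Z X} {τ τ' : GBispan Z Y}
    (hσ : σ.IsIso σ') (hτ : τ.IsIso τ') : (σ.pair τ).IsIso (σ'.pair τ') := by
  obtain ⟨α, β, hα, hβ, hp, hq, hr⟩ := hσ
  obtain ⟨α', β', hα', hβ', hp', hq', hr'⟩ := hτ
  refine ⟨Equiv.sumCongr α α', Equiv.sumCongr β β', ?_, ?_, ?_, ?_, ?_⟩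
  · rintro g (a | a)
    · exact congrArg Sum.inl (hα g a)
    · exact congrArg Sum.inr (hα' g a)
  · rintro g (a | a)
    · exact congrArg Sum.inl (hβ g a)
    · exact congrArg Sum.inr (hβ' g a)
  · rintro (a | a)
    · exact hp a
    · exact hp' a
  · rintro (a | a)
    · exact congrArg Sum.inl (hq a)
    · exact congrArg Sum.inr (hq' a)
  · rintro (a | a)
    · exact congrArg Sum.inl (hr a)
    · exact congrArg Sum.inr (hr' a)

/-- The composite of a bispan with `R_f`, described by pulling back along `f`. -/
abbrev GBispan.restrict {Z Y X : FinGSet G} (ω : GBispan Z Y) (f : X →[G] Y) : GBispan Z X where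
  A := FinGSet.pullback (ω.r.comp ω.q) f
  B := FinGSet.pullback ω.r f
  p := ω.p.comp (FinGSet.pullback.fst (ω.r.comp ω.q) f)
  q :=
    { toFun := fun t => ⟨ω.q t.fst, t.snd, t.w⟩
      map_smul' := fun g t => FinGSet.Pullback.ext (map_smul ω.q g t.fst) rfl }
  r := FinGSet.pullback.snd ω.r f

theorem GBispan.comp_R {Z Y X : FinGSet G} (ω : GBispan Z Y) (f : X →[G] Y) :
    (ω.comp (GBispan.R f)).IsIso (ω.restrict f) := by
  refine ⟨⟨fun t : CompA ω (R f) => (⟨t.fst, t.snd.fst,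
      (congrArg ω.r t.w).trans (t.snd.snd.spec _ _)⟩ : FinGSet.Pullback (ω.r.comp ω.q) f),
    fun t : FinGSet.Pullback (ω.r.comp ω.q) f =>
      (⟨t.fst, ⟨t.snd, ⟨t.snd, fun _ _ => ω.q t.fst,
        fun a h => t.w.trans (congrArg f h.symm)⟩, rfl⟩, rfl⟩ : CompA ω (R f)),
    fun t : CompA ω (R f) => ?_, fun t => rfl⟩,
    ⟨fun x : CompB ω (R f) => (⟨x.sec x.base rfl, x.base, x.spec _ _⟩ : FinGSet.Pullback ω.r f),
    fun t : FinGSet.Pullback ω.r f =>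
      (⟨t.snd, fun _ _ => t.fst, fun a h => t.w.trans (congrArg f h.symm)⟩ : CompB ω (R f)),
    fun x : CompB ω (R f) => ?_, fun t => rfl⟩,
    fun g t => rfl, fun g (x : CompB ω (R f)) => ?_, fun t => rfl, fun t : CompA ω (R f) => ?_,
    fun x => rfl⟩
  · refine compA_ext rfl rfl (FinGSet.Sec.ext' t.snd.w fun a h₁ h₂ => ?_)
    exact t.w.trans (FinGSet.Sec.sec_congr (x := t.snd.snd) rfl (t.snd.w.trans h₂.symm) _ _)
  · exact FinGSet.Sec.ext' rfl fun a h₁ h₂ =>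
      FinGSet.Sec.sec_congr (x := x) rfl h₂.symm _ _
  · refine FinGSet.Pullback.ext ?_ rfl
    exact congrArg (fun b : ω.B => g • b)
      (FinGSet.Sec.sec_congr (x := x) rfl (inv_smul_smul g x.base) _ _)
  · refine FinGSet.Pullback.ext ?_ t.snd.w
    exact t.w.trans (FinGSet.Sec.sec_congr (x := t.snd.snd) rfl t.snd.w _ _)

theorem FinGSet.bijective_pullback_inl {A A' X Y : FinGSet G} (q : A →[G] X) (q' : A' →[G] Y) :
    Function.Bijective (fun a : A =>
      (⟨Sum.inl a, q a, rfl⟩ : Pullback (sumMap q q') (inl X Y))) := by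
  constructor
  · intro a a' h
    exact Sum.inl_injective (congrArg Pullback.fst h)
  · rintro ⟨a | a, x, h⟩
    · obtain rfl : q a = x := Sum.inl_injective h
      exact ⟨a, rfl⟩
    · exact (Sum.inr_ne_inl h).elim

theorem FinGSet.bijective_pullback_inr {A A' X Y : FinGSet G} (q : A →[G] X) (q' : A' →[G] Y) :
    Function.Bijective (fun a : A' =>
      (⟨Sum.inr a, q' a, rfl⟩ : Pullback (sumMap q q') (inr X Y))) := by
  constructor
  · intro a a' h
    exact Sum.inr_injective (congrArg Pullback.fst h)
  · rintro ⟨a | a, x, h⟩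
    · exact (Sum.inl_ne_inr h).elim
    · obtain rfl : q' a = x := Sum.inr_injective h
      exact ⟨a, rfl⟩

theorem FinGSet.bijective_sumElim {A X Y : FinGSet G} (q : A →[G] X.sum Y) :
    Function.Bijective (sumElim (pullback.fst q (inl X Y)) (pullback.fst q (inr X Y))) := by
  constructor
  · rintro (⟨a, x, h⟩ | ⟨a, x, h⟩) (⟨b, y, h'⟩ | ⟨b, y, h'⟩) e
    · obtain rfl : a = b := e
      obtain rfl : x = y := Sum.inl_injective (h.symm.trans h')
      rfl
    · obtain rfl : a = b := e
      exact (Sum.inl_ne_inr (h.symm.trans h')).elim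
    · obtain rfl : a = b := e
      exact (Sum.inr_ne_inl (h.symm.trans h')).elim
    · obtain rfl : a = b := e
      obtain rfl : x = y := Sum.inr_injective (h.symm.trans h')
      rfl
  · intro a
    rcases h : (show X ⊕ Y from q a) with x | y
    · exact ⟨Sum.inl ⟨a, x, h⟩, rfl⟩
    · exact ⟨Sum.inr ⟨a, y, h⟩, rfl⟩

theorem GSpan.pair_inl {Z X Y : FinGSet G} (σ : GSpan Z X) (τ : GSpan Z Y) :
    ((σ.pair τ).comp (R (FinGSet.inl X Y))).IsIso σ :=
  (isIso_equivalence _ _).symm (IsIso.of_bijective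
    (σ' := (σ.pair τ).comp (R (FinGSet.inl X Y)))
    { toFun := fun a => (⟨Sum.inl a, σ.q a, rfl⟩ :
        FinGSet.Pullback (FinGSet.sumMap σ.q τ.q) (FinGSet.inl X Y))
      map_smul' := fun g a => FinGSet.Pullback.ext rfl (map_smul σ.q g a) }
    (FinGSet.bijective_pullback_inl _ _) (fun _ => rfl) fun _ => rfl)

theorem GSpan.pair_inr {Z X Y : FinGSet G} (σ : GSpan Z X) (τ : GSpan Z Y) :
    ((σ.pair τ).comp (R (FinGSet.inr X Y))).IsIso τ :=
  (isIso_equivalence _ _).symm (IsIso.of_bijective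
    (σ' := (σ.pair τ).comp (R (FinGSet.inr X Y)))
    { toFun := fun a => (⟨Sum.inr a, τ.q a, rfl⟩ :
        FinGSet.Pullback (FinGSet.sumMap σ.q τ.q) (FinGSet.inr X Y))
      map_smul' := fun g a => FinGSet.Pullback.ext rfl (map_smul τ.q g a) }
    (FinGSet.bijective_pullback_inr _ _) (fun _ => rfl) fun _ => rfl)

theorem GSpan.pair_eta {Z X Y : FinGSet G} (σ : GSpan Z (X.sum Y)) :
    ((σ.comp (R (FinGSet.inl X Y))).pair (σ.comp (R (FinGSet.inr X Y)))).IsIso σ :=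
  IsIso.of_bijective (FinGSet.sumElim (FinGSet.pullback.fst σ.q (FinGSet.inl X Y))
      (FinGSet.pullback.fst σ.q (FinGSet.inr X Y))) (FinGSet.bijective_sumElim σ.q)
    (by rintro (a | a) <;> rfl) (by
      rintro (a | a)
      · exact FinGSet.Pullback.w a
      · exact FinGSet.Pullback.w a)

theorem GBispan.pair_inl {Z X Y : FinGSet G} (σ : GBispan Z X) (τ : GBispan Z Y) :
    ((σ.pair τ).comp (R (FinGSet.inl X Y))).IsIso σ := by
  refine (isIso_equivalence _ _).trans (comp_R _ _) ((isIso_equivalence _ _).symm ?_)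
  refine IsIso.of_bijective (ω' := (σ.pair τ).restrict (FinGSet.inl X Y))
    { toFun := fun a => (⟨Sum.inl a, σ.r (σ.q a), rfl⟩ : FinGSet.Pullback
        ((FinGSet.sumMap σ.r τ.r).comp (FinGSet.sumMap σ.q τ.q)) (FinGSet.inl X Y))
      map_smul' := fun g a => FinGSet.Pullback.ext rfl (map_smul (σ.r.comp σ.q) g a) }
    { toFun := fun a => (⟨Sum.inl a, σ.r a, rfl⟩ : FinGSet.Pullback
        (FinGSet.sumMap σ.r τ.r) (FinGSet.inl X Y))
      map_smul' := fun g a => FinGSet.Pullback.ext rfl (map_smul σ.r g a) }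
    ?_ (FinGSet.bijective_pullback_inl _ _) (fun _ => rfl) (fun _ => rfl) fun _ => rfl
  constructor
  · intro a a' h
    exact Sum.inl_injective (congrArg FinGSet.Pullback.fst h)
  · rintro ⟨a | a, x, h⟩
    · obtain rfl : σ.r (σ.q a) = x := Sum.inl_injective h
      exact ⟨a, rfl⟩
    · exact (Sum.inr_ne_inl h).elim

theorem GBispan.pair_inr {Z X Y : FinGSet G} (σ : GBispan Z X) (τ : GBispan Z Y) :
    ((σ.pair τ).comp (R (FinGSet.inr X Y))).IsIso τ := by
  refine (isIso_equivalence _ _).trans (comp_R _ _) ((isIso_equivalence _ _).symm ?_)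
  refine IsIso.of_bijective (ω' := (σ.pair τ).restrict (FinGSet.inr X Y))
    { toFun := fun a => (⟨Sum.inr a, τ.r (τ.q a), rfl⟩ : FinGSet.Pullback
        ((FinGSet.sumMap σ.r τ.r).comp (FinGSet.sumMap σ.q τ.q)) (FinGSet.inr X Y))
      map_smul' := fun g a => FinGSet.Pullback.ext rfl (map_smul (τ.r.comp τ.q) g a) }
    { toFun := fun a => (⟨Sum.inr a, τ.r a, rfl⟩ : FinGSet.Pullback
        (FinGSet.sumMap σ.r τ.r) (FinGSet.inr X Y))
      map_smul' := fun g a => FinGSet.Pullback.ext rfl (map_smul τ.r g a) }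
    ?_ (FinGSet.bijective_pullback_inr _ _) (fun _ => rfl) (fun _ => rfl) fun _ => rfl
  constructor
  · intro a a' h
    exact Sum.inr_injective (congrArg FinGSet.Pullback.fst h)
  · rintro ⟨a | a, x, h⟩
    · exact (Sum.inl_ne_inr h).elim
    · obtain rfl : τ.r (τ.q a) = x := Sum.inr_injective h
      exact ⟨a, rfl⟩

theorem GBispan.pair_eta {Z X Y : FinGSet G} (ω : GBispan Z (X.sum Y)) :
    ((ω.comp (R (FinGSet.inl X Y))).pair (ω.comp (R (FinGSet.inr X Y)))).IsIso ω := by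
  refine (isIso_equivalence _ _).trans (pair_congr (comp_R _ _) (comp_R _ _)) ?_
  refine IsIso.of_bijective
    (FinGSet.sumElim (FinGSet.pullback.fst (ω.r.comp ω.q) (FinGSet.inl X Y))
      (FinGSet.pullback.fst (ω.r.comp ω.q) (FinGSet.inr X Y)))
    (FinGSet.sumElim (FinGSet.pullback.fst ω.r (FinGSet.inl X Y))
      (FinGSet.pullback.fst ω.r (FinGSet.inr X Y)))
    (FinGSet.bijective_sumElim (ω.r.comp ω.q)) (FinGSet.bijective_sumElim ω.r) ?_ ?_ ?_
  · rintro (a | a) <;> rfl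
  · rintro (a | a) <;> rfl
  · rintro (b | b)
    · exact FinGSet.Pullback.w b
    · exact FinGSet.Pullback.w b

/-- The disjoint union is a product in the span category, with projections `R_i` and `R_j`. -/
def SpanCat.isLimitSum (X Y : FinGSet G) :
    IsLimit (BinaryFan.mk (GSpan.R (FinGSet.inl X Y)).hom (GSpan.R (FinGSet.inr X Y)).hom) :=
  BinaryFan.IsLimit.mk _
    (fun {Z} f g => Quotient.map₂ (sa := GSpan.setoid (G := G) Z X)
      (sb := GSpan.setoid (G := G) Z Y) (sc := GSpan.setoid (G := G) Z (X.sum Y))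
      GSpan.pair (fun _ _ h _ _ h' => GSpan.pair_congr h h') f g)
    (by
      rintro Z ⟨σ⟩ ⟨τ⟩
      exact Quotient.sound (GSpan.pair_inl σ τ))
    (by
      rintro Z ⟨σ⟩ ⟨τ⟩
      exact Quotient.sound (GSpan.pair_inr σ τ))
    (by
      rintro Z _ _ ⟨σ⟩ rfl rfl
      exact (Quotient.sound (GSpan.pair_eta σ)).symm)

/-- The disjoint union is a product in the bispan category, with projections `R_i` and `R_j`. -/
def BispanCat.isLimitSum (X Y : FinGSet G) :
    IsLimit (BinaryFan.mk (GBispan.R (FinGSet.inl X Y)).hom (GBispan.R (FinGSet.inr X Y)).hom) :=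
  BinaryFan.IsLimit.mk _
    (fun {Z} f g => Quotient.map₂ (sa := GBispan.setoid (G := G) Z X)
      (sb := GBispan.setoid (G := G) Z Y) (sc := GBispan.setoid (G := G) Z (X.sum Y))
      GBispan.pair (fun _ _ h _ _ h' => GBispan.pair_congr h h') f g)
    (by
      rintro Z ⟨σ⟩ ⟨τ⟩
      exact Quotient.sound (GBispan.pair_inl σ τ))
    (by
      rintro Z ⟨σ⟩ ⟨τ⟩
      exact Quotient.sound (GBispan.pair_inr σ τ))
    (by
      rintro Z _ _ ⟨σ⟩ rfl rfl
      exact (Quotient.sound (GBispan.pair_eta σ)).symm)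

instance : IsEmpty (FinGSet.empty G) := inferInstanceAs (IsEmpty PEmpty)

/-- The map from the empty `G`-set. -/
def FinGSet.emptyElim (X : FinGSet G) : FinGSet.empty G →[G] X where
  toFun x := isEmptyElim x
  map_smul' _ x := isEmptyElim x

theorem GSpan.isIso_emptyElim {X : FinGSet G} (σ : GSpan X (FinGSet.empty G)) :
    σ.IsIso (R (FinGSet.emptyElim X)) := by
  have : IsEmpty σ.A := Function.isEmpty (fun a => σ.q a)
  exact ⟨Equiv.equivOfIsEmpty _ _, fun _ a => isEmptyElim a, fun a => isEmptyElim a,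
    fun a => isEmptyElim a⟩

theorem GBispan.isIso_emptyElim {X : FinGSet G} (ω : GBispan X (FinGSet.empty G)) :
    ω.IsIso (R (FinGSet.emptyElim X)) := by
  have : IsEmpty ω.B := Function.isEmpty (fun b => ω.r b)
  have : IsEmpty ω.A := Function.isEmpty (fun a => ω.q a)
  exact ⟨Equiv.equivOfIsEmpty _ _, Equiv.equivOfIsEmpty _ _, fun _ a => isEmptyElim a,
    fun _ a => isEmptyElim a, fun a => isEmptyElim a, fun a => isEmptyElim a,
    fun a => isEmptyElim a⟩

/-- The empty `G`-set is terminal in the span category. -/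
def SpanCat.isTerminalEmpty : IsTerminal (SpanCat.of (FinGSet.empty G)) :=
  IsTerminal.ofUniqueHom (fun X => (GSpan.R (FinGSet.emptyElim (G := G) X)).hom) (by
    rintro X ⟨σ⟩
    exact Quotient.sound (GSpan.isIso_emptyElim σ))

/-- The empty `G`-set is terminal in the bispan category. -/
def BispanCat.isTerminalEmpty : IsTerminal (BispanCat.of (FinGSet.empty G)) :=
  IsTerminal.ofUniqueHom (fun X => (GBispan.R (FinGSet.emptyElim (G := G) X)).hom) (by
    rintro X ⟨ω⟩
    exact Quotient.sound (GBispan.isIso_emptyElim ω))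

instance : HasFiniteProducts (SpanCat G) :=
  have : HasTerminal (SpanCat G) := SpanCat.isTerminalEmpty.hasTerminal
  have : HasBinaryProducts (SpanCat G) :=
    have : ∀ {X Y : SpanCat G}, HasLimit (Limits.pair X Y) := fun {X Y} =>
      HasLimit.mk ⟨_, SpanCat.isLimitSum X Y⟩
    hasBinaryProducts_of_hasLimit_pair _
  hasFiniteProducts_of_has_binary_and_terminal

instance : HasFiniteProducts (BispanCat G) :=
  have : HasTerminal (BispanCat G) := BispanCat.isTerminalEmpty.hasTerminal
  have : HasBinaryProducts (BispanCat G) :=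
    have : ∀ {X Y : BispanCat G}, HasLimit (Limits.pair X Y) := fun {X Y} =>
      HasLimit.mk ⟨_, BispanCat.isLimitSum X Y⟩
    hasBinaryProducts_of_hasLimit_pair _
  hasFiniteProducts_of_has_binary_and_terminal

instance : PreservesFiniteProducts (spanToBispan G) := by
  have h₀ : PreservesLimit (Functor.empty.{0} (SpanCat G)) (spanToBispan G) :=
    preservesLimit_of_preserves_limit_cone SpanCat.isTerminalEmpty
      ((isLimitMapConeEmptyConeEquiv _ _).symm BispanCat.isTerminalEmpty)
  have : PreservesLimitsOfShape (Discrete.{0} PEmpty) (spanToBispan G) :=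
    preservesLimitsOfShape_pempty_of_preservesTerminal _
  have : PreservesLimitsOfShape (Discrete WalkingPair) (spanToBispan G) := by
    constructor
    intro K
    have : PreservesLimit (Limits.pair (K.obj ⟨WalkingPair.left⟩) (K.obj ⟨WalkingPair.right⟩))
        (spanToBispan G) :=
      preservesLimit_of_preserves_limit_cone (SpanCat.isLimitSum _ _)
        ((isLimitMapConeBinaryFanEquiv _ _ _).symm (BispanCat.isLimitSum _ _))
    exact preservesLimit_of_iso_diagram _ (diagramIsoPair K).symm
  exact .of_preserves_binary_and_terminal _

end Products

/-! ## Mackey functors and Tambara functors -/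

/-- The category of Mackey functors: product-preserving functors from the span category to sets. -/
abbrev Mackey (G : Type u) [Group G] : Type (max (u + 1) (w + 1)) :=
  ObjectProperty.FullSubcategory
    (fun F : SpanCat G ⥤ Type w => PreservesFiniteProducts F)

/-- The category of Tambara functors: product-preserving functors from the bispan category to
sets. -/
abbrev Tambara (G : Type u) [Group G] : Type (max (u + 1) (w + 1)) :=
  ObjectProperty.FullSubcategory
    (fun F : BispanCat G ⥤ Type w => PreservesFiniteProducts F)

namespace Mackey

variable {G : Type u} [Group G]

/-- The set `M(X)`. -/
abbrev val (M : Mackey.{u, w} G) (X : FinGSet G) : Type w := M.obj.obj (SpanCat.of X)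

/-- The operation `R_f : M(Y) → M(X)`. -/
def R (M : Mackey.{u, w} G) {X Y : FinGSet G} (f : X →[G] Y) (m : val M Y) : val M X :=
  M.obj.map (GSpan.R f).hom m

/-- The operation `T_f : M(X) → M(Y)`. -/
def T (M : Mackey.{u, w} G) {X Y : FinGSet G} (f : X →[G] Y) (m : val M X) : val M Y :=
  M.obj.map (GSpan.T f).hom m

/-- The component at `X` of a morphism of Mackey functors. -/
def app {M M' : Mackey.{u, w} G} (φ : M ⟶ M') (X : FinGSet G) (m : val M X) : val M' X :=
  φ.hom.app (SpanCat.of X) m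

theorem R_id (M : Mackey.{u, w} G) {X : FinGSet G} (m : val M X) : R M (.id G) m = m :=
  congrArg (fun f : M.obj.obj (SpanCat.of X) ⟶ M.obj.obj (SpanCat.of X) => f m)
    (M.obj.map_id (SpanCat.of X))

theorem R_comp (M : Mackey.{u, w} G) {X Y Z : FinGSet G} (f : X →[G] Y) (g : Y →[G] Z)
    (m : val M Z) : R M (g.comp f) m = R M f (R M g m) := by
  have h : (GSpan.R (g.comp f)).hom = (GSpan.R g).hom ≫ (GSpan.R f).hom := by
    refine Quotient.sound (GSpan.IsIso.of_bijective (σ' := (GSpan.R g).comp (GSpan.R f))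
      { toFun := fun a => (⟨f a, a, rfl⟩ : FinGSet.Pullback (.id G) f)
        map_smul' := fun a x => FinGSet.Pullback.ext (map_smul f a x) rfl }
      ⟨fun a b h => congrArg FinGSet.Pullback.snd h, fun t : FinGSet.Pullback (.id G) f =>
        ⟨t.snd, FinGSet.Pullback.ext t.w.symm rfl⟩⟩ (fun _ => rfl) fun _ => rfl)
  unfold R
  rw [h, Functor.map_comp]
  rfl

end Mackey

namespace Tambara

variable {G : Type u} [Group G]

/-- The set `S(X)`. -/
abbrev val (S : Tambara.{u, w} G) (X : FinGSet G) : Type w := S.obj.obj (BispanCat.of X)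

/-- The operation `R_f : S(Y) → S(X)`. -/
def R (S : Tambara.{u, w} G) {X Y : FinGSet G} (f : X →[G] Y) (s : val S Y) : val S X :=
  S.obj.map (GBispan.R f).hom s

/-- The operation `N_f : S(X) → S(Y)`. -/
def N (S : Tambara.{u, w} G) {X Y : FinGSet G} (f : X →[G] Y) (s : val S X) : val S Y :=
  S.obj.map (GBispan.N f).hom s

/-- The operation `T_f : S(X) → S(Y)`. -/
def T (S : Tambara.{u, w} G) {X Y : FinGSet G} (f : X →[G] Y) (s : val S X) : val S Y :=
  S.obj.map (GBispan.T f).hom s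

/-- The component at `X` of a morphism of Tambara functors. -/
def app {S S' : Tambara.{u, w} G} (φ : S ⟶ S') (X : FinGSet G) (s : val S X) : val S' X :=
  φ.hom.app (BispanCat.of X) s

/-- The functor `U` from Tambara functors to Mackey functors. The Mackey functor `U S` is the
*underlying multiplicative Mackey functor* of `S`, given by precomposition with `spanToBispan`:
it has the same sets and the same `R_f` as `S`, and its `T_f` is the `N_f` of `S`. -/
def U (G : Type u) [Group G] : Tambara.{u, w} G ⥤ Mackey.{u, w} G :=
  ObjectProperty.lift _
    (ObjectProperty.ι _ ⋙ (Functor.whiskeringLeft _ _ _).obj (spanToBispan G))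
    fun S => by
      have := S.property
      exact comp_preservesFiniteProducts (spanToBispan G) S.obj

theorem U_R (S : Tambara.{u, w} G) {X Y : FinGSet G} (f : X →[G] Y) (s : val S Y) :
    Mackey.R ((U G).obj S) f s = R S f s := rfl

theorem U_T (S : Tambara.{u, w} G) {X Y : FinGSet G} (f : X →[G] Y) (s : val S X) :
    Mackey.T ((U G).obj S) f s = N S f s := rfl

end Tambara

/-! ## The sets `A[M](X)` and the operations on them -/

/-- A triple `(U, u, m)` where `U` is a finite `G`-set, `u : U → X` is equivariant and
`m ∈ M(U)`. -/
structure MTriple {G : Type u} [Group G] (M : Mackey.{u, w} G) (X : FinGSet G) :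
    Type (max (u + 1) w) where
  U : FinGSet G
  u : U →[G] X
  m : Mackey.val M U

namespace MTriple

variable {G : Type u} [Group G] {M : Mackey.{u, w} G}

/-- Two triples `(U, u, m)` and `(U', u', m')` are isomorphic if there is an equivariant bijection
`e : U → U'` with `u' e = u` and `R_e(m') = m`. -/
def IsIso {X : FinGSet G} (z z' : MTriple M X) : Prop :=
  ∃ e : z.U →[G] z'.U, Function.Bijective e ∧ z'.u.comp e = z.u ∧ Mackey.R M e z'.m = z.m

theorem isIso_equivalence (M : Mackey.{u, w} G) (X : FinGSet G) :
    Equivalence (IsIso (M := M) (X := X)) where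
  refl z := ⟨.id G, Function.bijective_id, rfl, Mackey.R_id M _⟩
  symm := by
    rintro z z' ⟨e, he, hu, hm⟩
    let E := Equiv.ofBijective e he
    let i : z'.U →[G] z.U :=
      { toFun := E.symm
        map_smul' := fun g x => by
          rw [Equiv.symm_apply_eq]
          refine ((map_smul e g _).trans ?_).symm
          exact congrArg (g • ·) (E.apply_symm_apply x) }
    have hi : e.comp i = .id G := MulActionHom.ext fun x => E.apply_symm_apply x
    refine ⟨i, E.symm.bijective, ?_, ?_⟩
    · rw [← hu]
      exact congrArg (fun f : z'.U →[G] z'.U => z'.u.comp f) hi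
    · rw [← hm, ← Mackey.R_comp, hi, Mackey.R_id]
  trans := by
    rintro z z' z'' ⟨e, he, hu, hm⟩ ⟨e', he', hu', hm'⟩
    refine ⟨e'.comp e, he'.comp he, ?_, ?_⟩
    · rw [← hu, ← hu']
      rfl
    · rw [Mackey.R_comp, hm', hm]

instance setoid (M : Mackey.{u, w} G) (X : FinGSet G) : Setoid (MTriple M X) :=
  ⟨IsIso, isIso_equivalence M X⟩

/-- `T_g (U, u, m) = (U, g u, m)`. -/
def T {X Y : FinGSet G} (g : X →[G] Y) (z : MTriple M X) : MTriple M Y := ⟨z.U, g.comp z.u, z.m⟩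

/-- `N_g (U, u, m) = (B, r, T_q R_p m)` where `(U ⟵p A ⟶q B ⟶r Y)` is the distributor of
`U ⟶u X ⟶g Y`. -/
def N {X Y : FinGSet G} (g : X →[G] Y) (z : MTriple M X) : MTriple M Y where
  U := (GBispan.distributor z.u g).B
  u := (GBispan.distributor z.u g).r
  m := Mackey.T M (GBispan.distributor z.u g).q (Mackey.R M (GBispan.distributor z.u g).p z.m)

/-- `R_f (U, u, m) = (U ×_X W, projection to W, R_π m)` where `π : U ×_X W → U` is the
projection. -/
def R {W X : FinGSet G} (f : W →[G] X) (z : MTriple M X) : MTriple M W where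
  U := FinGSet.pullback z.u f
  u := FinGSet.pullback.snd z.u f
  m := Mackey.R M (FinGSet.pullback.fst z.u f) z.m

/-- The map induced by a morphism of Mackey functors: `(U, u, m) ↦ (U, u, φ m)`. -/
def map {M' : Mackey.{u, w} G} (φ : M ⟶ M') {X : FinGSet G} (z : MTriple M X) : MTriple M' X :=
  ⟨z.U, z.u, Mackey.app φ z.U z.m⟩

/-- The triple `(X, 1, m)`. -/
def unit {X : FinGSet G} (m : Mackey.val M X) : MTriple M X := ⟨X, .id G, m⟩

end MTriple

/-- The set `A[M](X)` of isomorphism classes of triples `(U, u, m)`. -/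
def AM {G : Type u} [Group G] (M : Mackey.{u, w} G) (X : FinGSet G) : Type (max (u + 1) w) :=
  Quotient (MTriple.setoid M X)

/-- The isomorphism class `[U, u, m]`. -/
def AM.mk {G : Type u} [Group G] {M : Mackey.{u, w} G} {X : FinGSet G} (z : MTriple M X) :
    AM M X :=
  Quotient.mk (MTriple.setoid M X) z

end

/-!
The class `[U, u, m]` stands for the expression `T_u m`, where the restrictions and transfers of
`M` play the part of the restrictions and norms of a Tambara functor. More generally, a bispan
`ω = (X ⟵p A ⟶q B ⟶r Y)` and `m ∈ M(X)` give the class `[ω; m] = [B, r, T_q R_p m]` in `A[M](Y)`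
(`AM.ofBispan`), which stands for `T_r N_q R_p m`.

The one relation that carries the proof is `[σ ≫ ω; m] = [ω; M(σ) m]` for a span `σ`
(`AM.ofBispan_toBispan_comp`): precomposing a bispan with a span `σ` only changes its first two
legs, and changes them by composition of spans (`GBispan.toBispan_comp_isIso`). In other words
`A[M]` is the left Kan extension of `M` along the functor from spans to bispans. A bispan `ω`
acts by `[U, u, m] ↦ [T_u ≫ ω; m]`. The relation, together with `T_{ve} R_e = T_v` for bijective
`e`, shows that this is well defined; together with `ω = span ≫ T_r` it gives
`ω' [ω; m] = [ω ≫ ω'; m]` (`AM.act_ofBispan`), hence functoriality. The formulas for `T_g`, `N_g`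
and `R_f` are computations of the bispans `T_u ≫ T_g`, `T_u ≫ N_g` and `T_u ≫ R_f`; the second of
these is the distributor.

The functor preserves finite products because a `G`-set over `X ⊔ Y` splits as a disjoint union
and `M` takes disjoint unions to products (`AM.sumEquiv`). As `G` is finite, there are countably
many isomorphism classes of finite `G`-sets, so `A[M](X)` has a copy in the universe of the values
of `M`.

The counit `[U, u, s] ↦ T_u s` sends `[ω; s]` to `S(ω) s`, and the unit sends `m` to
`[1; m]`. Both are therefore compatible with the actions of bispans and of spans, respectively,
and the triangular identities amount to `T_u [U, 1, m] = [U, u, m]` and `T_1 s = s`.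
-/

noncomputable section

/-! ### Composites of spans -/

namespace GSpan

variable {G : Type u} [Group G]

theorem hom_eq {X Y : FinGSet G} {σ σ' : GSpan X Y} (h : σ.IsIso σ') : σ.hom = σ'.hom :=
  Quotient.sound h

theorem hom_comp {X Y Z : FinGSet G} (σ : GSpan X Y) (τ : GSpan Y Z) :
    (σ.comp τ).hom = σ.hom ≫ τ.hom := rfl

/-- A span `X ⟵p A ⟶q Y` is the composite `T_q R_p`. -/
theorem R_comp_T {X Y A : FinGSet G} (p : A →[G] X) (q : A →[G] Y) :
    (R p).hom ≫ (T q).hom = GSpan.hom ⟨A, p, q⟩ :=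
  (hom_eq (IsIso.of_bijective (σ := ⟨A, p, q⟩) (σ' := (R p).comp (T q))
    { toFun := fun a => (⟨a, a, rfl⟩ : FinGSet.Pullback (.id G) (.id G))
      map_smul' := fun _ _ => rfl }
    ⟨fun _ _ h => congrArg FinGSet.Pullback.fst h, fun t : FinGSet.Pullback (.id G) (.id G) =>
      ⟨t.fst, FinGSet.Pullback.ext rfl t.w⟩⟩ (fun _ => rfl) fun _ => rfl)).symm

end GSpan

/-! ### Isomorphisms between composites of bispans -/

namespace GBispan

variable {G : Type u} [Group G]

theorem hom_eq {X Y : FinGSet G} {ω ω' : GBispan X Y} (h : ω.IsIso ω') : ω.hom = ω'.hom :=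
  Quotient.sound h

theorem hom_comp {X Y Z : FinGSet G} (ω : GBispan X Y) (ω' : GBispan Y Z) :
    (ω.comp ω').hom = ω.hom ≫ ω'.hom := rfl

/-- The part `X ⟵p A ⟶q B` of a bispan `X ⟵p A ⟶q B ⟶r Y`. -/
abbrev span {X Y : FinGSet G} (ω : GBispan X Y) : GSpan X ω.B := ⟨ω.A, ω.p, ω.q⟩

/-- Precomposing a bispan `(U ⟵p A ⟶q B ⟶r Y)` with a span `σ` from `V` to `U` leaves `B` and
`r` unchanged and replaces the span `(p, q)` by its composite with `σ`. Indeed the sections that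
occur in the composite are sections of the identity of `U`, hence unique. -/
theorem toBispan_comp_isIso {V U Y : FinGSet G} (σ : GSpan V U) (ω : GBispan U Y) :
    (GBispan.mk (σ.comp ω.span).A ω.B (σ.comp ω.span).p (σ.comp ω.span).q ω.r).IsIso
      (σ.toBispan.comp ω) := by
  refine ⟨⟨fun t : FinGSet.Pullback σ.q ω.p =>
      (⟨t.fst, ⟨t.snd, ⟨ω.q t.snd, fun a _ => ω.p a, fun _ _ => rfl⟩, rfl⟩, t.w⟩ :
        CompA σ.toBispan ω),
    fun t : CompA σ.toBispan ω =>
      (⟨t.fst, t.snd.fst, t.w.trans (t.snd.snd.spec _ _)⟩ : FinGSet.Pullback σ.q ω.p),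
    fun t => rfl, fun t : CompA σ.toBispan ω => ?_⟩,
    ⟨fun b => (⟨b, fun a _ => ω.p a, fun _ _ => rfl⟩ : CompB σ.toBispan ω),
      fun x : CompB σ.toBispan ω => x.base, fun b => rfl,
      fun x : CompB σ.toBispan ω => ?_⟩,
    fun g t => ?_, fun g b => ?_, fun t => rfl, fun t => rfl, fun b => rfl⟩
  · exact compA_ext rfl rfl
      (FinGSet.Sec.ext' t.snd.w fun a h₁ h₂ => (t.snd.snd.spec a h₂).symm)
  · exact FinGSet.Sec.ext' rfl fun a h₁ h₂ => (x.spec a h₂).symm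
  · refine compA_ext rfl rfl (FinGSet.Sec.ext' (map_smul ω.q g _) fun a h₁ h₂ => ?_)
    exact ((map_smul ω.p g _).symm.trans (congrArg ω.p (smul_inv_smul g a))).symm
  · refine FinGSet.Sec.ext' rfl fun a h₁ h₂ => ?_
    exact ((map_smul ω.p g _).symm.trans (congrArg ω.p (smul_inv_smul g a))).symm

/-- Every bispan `X ⟵p A ⟶q B ⟶r Y` is the composite of the span `X ⟵p A ⟶q B`
and `T_r`. -/
theorem span_comp_T {X Y : FinGSet G} (ω : GBispan X Y) :
    (ω.span.toBispan.comp (T ω.r)).IsIso ω := by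
  refine (isIso_equivalence _ _).trans
    ((isIso_equivalence _ _).symm (toBispan_comp_isIso ω.span (T ω.r))) ?_
  exact IsIso.of_bijective (FinGSet.pullback.fst ω.q (.id G)) (.id G)
    ⟨fun (s t : FinGSet.Pullback ω.q (.id G)) (h : s.fst = t.fst) =>
      FinGSet.Pullback.ext h (s.w.symm.trans ((congrArg ω.q h).trans t.w)),
      fun a => ⟨⟨a, ω.q a, rfl⟩, rfl⟩⟩
    Function.bijective_id (fun _ => rfl) (fun t => FinGSet.Pullback.w t) fun _ => rfl

theorem T_comp_T {X Y Z : FinGSet G} (f : X →[G] Y) (g : Y →[G] Z) :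
    ((T f).comp (T g)).IsIso (T (g.comp f)) := by
  refine (isIso_equivalence _ _).symm (IsIso.of_bijective (ω := T (g.comp f))
    (ω' := (T f).comp (T g))
    { toFun := fun x => (⟨x, ⟨f x, ⟨f x, fun _ _ => x, fun _ h => h.symm⟩, rfl⟩, rfl⟩ :
        CompA (T f) (T g))
      map_smul' := fun a x => compA_ext rfl (map_smul f a x)
        (FinGSet.Sec.ext' (map_smul f a x) fun _ _ _ => rfl) }
    { toFun := fun x => (⟨f x, fun _ _ => x, fun _ h => h.symm⟩ : CompB (T f) (T g))
      map_smul' := fun a x => FinGSet.Sec.ext' (map_smul f a x) fun _ _ _ => rfl }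
    ⟨fun x y h => congrArg FinGSet.Pullback.fst h, fun t : CompA (T f) (T g) => ⟨t.fst, ?_⟩⟩
    ⟨fun x y h => FinGSet.Sec.sec_congr h (h₂ := ?_)
      (congrArg FinGSet.Sec.base h) rfl, fun x : CompB (T f) (T g) => ⟨x.sec x.base rfl, ?_⟩⟩
    (fun _ => rfl) (fun _ => rfl) fun _ => rfl)
  · have hw : t.fst = t.snd.snd.sec t.snd.fst t.snd.w := t.w
    have h : f t.fst = t.snd.fst := (congrArg f hw).trans (t.snd.snd.spec _ _)
    exact compA_ext rfl h (FinGSet.Sec.ext' (h.trans t.snd.w) fun a h₁ h₂ =>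
      hw.trans (FinGSet.Sec.sec_congr rfl (t.snd.w.trans h₂.symm) _ _))
  · rfl
  · exact FinGSet.Sec.ext' (x.spec _ _) fun a h₁ h₂ =>
      FinGSet.Sec.sec_congr rfl h₂.symm _ _

/-- The distributor gives the exchange rule `N_g T_u = T_r N_q R_p`. -/
theorem T_comp_N {U X Y : FinGSet G} (u : U →[G] X) (g : X →[G] Y) :
    ((T u).comp (N g)).IsIso (distributor u g) :=
  IsIso.of_bijective (FinGSet.pullback.snd (.id G) (FinGSet.secs.eval (.id G) g u)) (.id G)
    ⟨fun (s t : CompA (T u) (N g)) (h : s.snd = t.snd) =>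
      FinGSet.Pullback.ext (s.w.trans ((congrArg _ h).trans t.w.symm)) h,
      fun t => ⟨⟨FinGSet.secs.eval (.id G) g u t, t, rfl⟩, rfl⟩⟩
    Function.bijective_id (fun t : CompA (T u) (N g) => t.w.symm) (fun _ => rfl) fun _ => rfl

/-- For a bijection `e`, one has `T_{ve} R_e = T_v`. This is what makes operations on triples
invariant under isomorphism. -/
theorem R_comp_T_of_bijective {U V X : FinGSet G} (e : U →[G] V) (he : Function.Bijective e)
    (v : V →[G] X) : ((GSpan.R e).toBispan.comp (T (v.comp e))).IsIso (T v) :=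
  (isIso_equivalence _ _).trans
    ((isIso_equivalence _ _).symm (toBispan_comp_isIso (GSpan.R e) (T (v.comp e))))
    (IsIso.of_bijective (e.comp (FinGSet.pullback.fst (.id G) (.id G))) e
      ⟨fun (s t : FinGSet.Pullback (.id G) (.id G)) h => by
        have h' : s.fst = t.fst := he.1 h
        exact FinGSet.Pullback.ext h' (s.w.symm.trans (h'.trans t.w)),
        fun v => by
          obtain ⟨a, rfl⟩ := he.2 v
          exact ⟨⟨a, a, rfl⟩, rfl⟩⟩
      he (fun _ => rfl) (fun t => congrArg e (FinGSet.Pullback.w t)) fun _ => rfl)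

end GBispan

/-! ### Operations on Mackey functors -/

namespace Mackey

variable {G : Type u} [Group G] (M : Mackey.{u, w} G)

/-- The action of a span on a Mackey functor. -/
def map {X Y : FinGSet G} (σ : GSpan X Y) (m : val M X) : val M Y := M.obj.map σ.hom m

theorem map_comp {X Y Z : FinGSet G} (σ : GSpan X Y) (τ : GSpan Y Z) (m : val M X) :
    map M (σ.comp τ) m = map M τ (map M σ m) := by
  unfold map
  rw [GSpan.hom_comp, Functor.map_comp]
  rfl

theorem map_congr {X Y : FinGSet G} {σ σ' : GSpan X Y} (h : σ.IsIso σ') (m : val M X) :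
    map M σ m = map M σ' m := by
  unfold map
  rw [GSpan.hom_eq h]

theorem map_one {X : FinGSet G} (m : val M X) : map M (GSpan.one X) m = m := R_id M m

/-- The composite `T_q R_p` is the action of the span `X ⟵p A ⟶q Y`. -/
theorem T_R {X Y A : FinGSet G} (p : A →[G] X) (q : A →[G] Y) (m : val M X) :
    T M q (R M p m) = map M ⟨A, p, q⟩ m := by
  refine (ConcreteCategory.congr_hom
    (M.obj.map_comp (GSpan.R p).hom (GSpan.T q).hom) m).symm.trans ?_
  rw [GSpan.R_comp_T]
  rfl

theorem app_map {M M' : Mackey.{u, w} G} (φ : M ⟶ M') {X Y : FinGSet G} (σ : GSpan X Y)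
    (m : val M X) : app φ Y (map M σ m) = map M' σ (app φ X m) :=
  ConcreteCategory.congr_hom (φ.hom.naturality σ.hom) m

theorem app_R {M M' : Mackey.{u, w} G} (φ : M ⟶ M') {X Y : FinGSet G} (f : X →[G] Y)
    (m : val M Y) : app φ X (R M f m) = R M' f (app φ Y m) :=
  app_map φ (GSpan.R f) m

/-- Elements of `M(X ⊔ Y)` are pairs of elements of `M(X)` and of `M(Y)`. -/
theorem bijective_R_sum (X Y : FinGSet G) : Function.Bijective fun m : val M (X.sum Y) =>
    (R M (FinGSet.inl X Y) m, R M (FinGSet.inr X Y) m) := by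
  have := M.property
  have h := (isLimitMapConeBinaryFanEquiv M.obj _ _)
    (isLimitOfPreserves M.obj (SpanCat.isLimitSum X Y))
  exact ((h.conePointUniqueUpToIso (Types.binaryProductLimit _ _)).toEquiv).bijective

/-- The element of `M(U ⊔ V)` with given restrictions to `U` and `V`. -/
def pair {M : Mackey.{u, w} G} {U V : FinGSet G} (m : val M U) (n : val M V) :
    val M (U.sum V) :=
  (Equiv.ofBijective _ (bijective_R_sum M U V)).symm (m, n)

theorem R_inl_pair {M : Mackey.{u, w} G} {U V : FinGSet G} (m : val M U) (n : val M V) :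
    R M (FinGSet.inl U V) (pair m n) = m :=
  congrArg Prod.fst
    ((Equiv.ofBijective _ (bijective_R_sum M U V)).apply_symm_apply (m, n))

theorem R_inr_pair {M : Mackey.{u, w} G} {U V : FinGSet G} (m : val M U) (n : val M V) :
    R M (FinGSet.inr U V) (pair m n) = n :=
  congrArg Prod.snd
    ((Equiv.ofBijective _ (bijective_R_sum M U V)).apply_symm_apply (m, n))

theorem ext_sum {M : Mackey.{u, w} G} {U V : FinGSet G} {m n : val M (U.sum V)}
    (h₁ : R M (FinGSet.inl U V) m = R M (FinGSet.inl U V) n)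
    (h₂ : R M (FinGSet.inr U V) m = R M (FinGSet.inr U V) n) : m = n :=
  (bijective_R_sum M U V).1 (Prod.ext h₁ h₂)

instance : Unique (val M (FinGSet.empty G)) :=
  have := M.property
  Types.isTerminalEquivUnique _ (SpanCat.isTerminalEmpty.isTerminalObj M.obj)

end Mackey

/-! ### Operations on Tambara functors -/

namespace Tambara

variable {G : Type u} [Group G] (S : Tambara.{u, w} G)

/-- The action of a bispan on a Tambara functor. -/
def map {X Y : FinGSet G} (ω : GBispan X Y) (s : val S X) : val S Y := S.obj.map ω.hom s

theorem map_comp {X Y Z : FinGSet G} (ω : GBispan X Y) (ω' : GBispan Y Z) (s : val S X) :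
    map S (ω.comp ω') s = map S ω' (map S ω s) := by
  unfold map
  rw [GBispan.hom_comp, Functor.map_comp]
  rfl

theorem map_congr {X Y : FinGSet G} {ω ω' : GBispan X Y} (h : ω.IsIso ω') (s : val S X) :
    map S ω s = map S ω' s := by
  unfold map
  rw [GBispan.hom_eq h]

theorem map_one {X : FinGSet G} (s : val S X) : map S (GBispan.one X) s = s :=
  ConcreteCategory.congr_hom (S.obj.map_id (BispanCat.of X)) s

theorem app_map {S S' : Tambara.{u, w} G} (φ : S ⟶ S') {X Y : FinGSet G} (ω : GBispan X Y)
    (s : val S X) : app φ Y (map S ω s) = map S' ω (app φ X s) :=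
  ConcreteCategory.congr_hom (φ.hom.naturality ω.hom) s

end Tambara

/-! ### The action of bispans on `A[M]` -/

namespace MTriple

variable {G : Type u} [Group G] {M : Mackey.{u, w} G}

/-- The triple `(B, r, T_q R_p m)` attached to a bispan `ω = (X ⟵p A ⟶q B ⟶r Y)` and
`m ∈ M(X)`. It represents the formal expression `T_r N_q R_p m`. -/
abbrev ofBispan {X Y : FinGSet G} (ω : GBispan X Y) (m : Mackey.val M X) : MTriple M Y :=
  ⟨ω.B, ω.r, Mackey.map M ω.span m⟩

theorem ofBispan_congr {X Y : FinGSet G} {ω ω' : GBispan X Y} (h : ω.IsIso ω')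
    (m : Mackey.val M X) : (ofBispan ω m).IsIso (ofBispan ω' m) := by
  obtain ⟨α, β, hα, hβ, hp, hq, hr⟩ := h
  refine ⟨{ toFun := β, map_smul' := hβ }, β.bijective, MulActionHom.ext hr, ?_⟩
  refine (Mackey.map_comp M ω'.span (GSpan.R _) m).symm.trans (Mackey.map_congr M ?_ m)
  refine (GSpan.isIso_equivalence _ _).symm (GSpan.IsIso.of_bijective (σ := ω.span)
    (σ' := ω'.span.comp (GSpan.R { toFun := β, map_smul' := hβ }))
    { toFun := fun a => (⟨α a, ω.q a, hq a⟩ : FinGSet.Pullback ω'.q { toFun := β, map_smul' := hβ })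
      map_smul' := fun g a => FinGSet.Pullback.ext (hα g a) (map_smul ω.q g a) }
    ⟨fun a b h => α.injective (congrArg FinGSet.Pullback.fst h), ?_⟩ hp fun _ => rfl)
  rintro ⟨a, b, h⟩
  obtain ⟨a, rfl⟩ := α.surjective a
  exact ⟨a, FinGSet.Pullback.ext rfl (β.injective ((hq a).symm.trans h))⟩

/-- The disjoint union of a triple over `X` and a triple over `Y`. -/
abbrev pair {X Y : FinGSet G} (z : MTriple M X) (z' : MTriple M Y) :
    MTriple M (X.sum Y) :=
  ⟨z.U.sum z'.U, FinGSet.sumMap z.u z'.u, Mackey.pair z.m z'.m⟩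

end MTriple

namespace AM

variable {G : Type u} [Group G] {M : Mackey.{u, w} G}

theorem mk_eq {X : FinGSet G} {z z' : MTriple M X} (h : z.IsIso z') : mk z = mk z' :=
  Quotient.sound h

/-- The class `[B, r, T_q R_p m]` attached to a bispan `X ⟵p A ⟶q B ⟶r Y` and
`m ∈ M(X)`. -/
def ofBispan {X Y : FinGSet G} (ω : GBispan X Y) (m : Mackey.val M X) : AM M Y :=
  mk (MTriple.ofBispan ω m)

theorem ofBispan_congr {X Y : FinGSet G} {ω ω' : GBispan X Y} (h : ω.IsIso ω')
    (m : Mackey.val M X) : ofBispan ω m = ofBispan ω' m :=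
  mk_eq (MTriple.ofBispan_congr h m)

/-- Spans can be moved between a bispan and the Mackey functor: this is the relation
that presents `A[M](Y)` as the coend of `M(X)` against bispans from `X` to `Y`. -/
theorem ofBispan_toBispan_comp {V U Y : FinGSet G} (σ : GSpan V U) (ω : GBispan U Y)
    (m : Mackey.val M V) : ofBispan (σ.toBispan.comp ω) m = ofBispan ω (Mackey.map M σ m) := by
  rw [← ofBispan_congr (GBispan.toBispan_comp_isIso σ ω), ofBispan, ofBispan]
  unfold MTriple.ofBispan
  rw [← Mackey.map_comp]

theorem ofBispan_T {U X : FinGSet G} (u : U →[G] X) (m : Mackey.val M U) :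
    ofBispan (GBispan.T u) m = mk ⟨U, u, m⟩ := by
  rw [ofBispan, MTriple.ofBispan, Mackey.map_one]

/-- The action of a bispan `ω` on `A[M]`. Since `[U, u, m]` stands for `T_u m`, it is sent to
the class attached to `T_u` followed by `ω`. -/
def act {X Y : FinGSet G} (ω : GBispan X Y) : AM M X → AM M Y :=
  Quotient.lift (fun z : MTriple M X => ofBispan ((GBispan.T z.u).comp ω) z.m) <| by
    rintro z z' ⟨e, he, hu, hm⟩
    rw [← hu, ← hm]
    refine (ofBispan_toBispan_comp (GSpan.R e) _ z'.m).symm.trans ?_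
    exact ofBispan_congr ((GBispan.isIso_equivalence _ Y).trans
      ((GBispan.isIso_equivalence _ Y).symm (GBispan.comp_assoc _ _ _))
      (GBispan.comp_congr (GBispan.R_comp_T_of_bijective e he z'.u)
        ((GBispan.isIso_equivalence X Y).refl ω))) z'.m

theorem act_mk {X Y : FinGSet G} (ω : GBispan X Y) (z : MTriple M X) :
    act ω (mk z) = ofBispan ((GBispan.T z.u).comp ω) z.m := rfl

/-- The formula defining the action holds for every presentation of a class by a bispan, not
only for the presentations `[U, u, m] = [T_u; m]`. Functoriality of the action follows. -/
theorem act_ofBispan {X Y Z : FinGSet G} (ω : GBispan X Y) (ω' : GBispan Y Z)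
    (m : Mackey.val M X) : act ω' (ofBispan ω m) = ofBispan (ω.comp ω') m := by
  have E := GBispan.isIso_equivalence X Z
  rw [ofBispan, act_mk, ← ofBispan_toBispan_comp]
  exact ofBispan_congr (E.trans (E.symm (GBispan.comp_assoc _ _ _))
    (GBispan.comp_congr (GBispan.span_comp_T ω) ((GBispan.isIso_equivalence Y Z).refl ω'))) m

theorem act_congr {X Y : FinGSet G} {ω ω' : GBispan X Y} (h : ω.IsIso ω') (x : AM M X) :
    act ω x = act ω' x := by
  obtain ⟨z⟩ := x
  exact ofBispan_congr (GBispan.comp_congr ((GBispan.isIso_equivalence _ _).refl _) h) z.m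

theorem act_one {X : FinGSet G} (x : AM M X) : act (GBispan.one X) x = x := by
  obtain ⟨z⟩ := x
  exact (ofBispan_congr (GBispan.comp_one _) z.m).trans (ofBispan_T z.u z.m)

theorem act_comp {X Y Z : FinGSet G} (ω : GBispan X Y) (ω' : GBispan Y Z) (x : AM M X) :
    act (ω.comp ω') x = act ω' (act ω x) := by
  obtain ⟨z⟩ := x
  refine Eq.trans ?_ (act_ofBispan _ ω' z.m).symm
  exact ofBispan_congr ((GBispan.isIso_equivalence _ _).symm (GBispan.comp_assoc _ _ _)) z.m

theorem act_T {X Y : FinGSet G} (g : X →[G] Y) (z : MTriple M X) :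
    act (GBispan.T g) (mk z) = mk (MTriple.T g z) :=
  (ofBispan_congr (GBispan.T_comp_T z.u g) z.m).trans (ofBispan_T _ z.m)

theorem act_N {X Y : FinGSet G} (g : X →[G] Y) (z : MTriple M X) :
    act (GBispan.N g) (mk z) = mk (MTriple.N g z) := by
  refine (ofBispan_congr (GBispan.T_comp_N z.u g) z.m).trans ?_
  rw [MTriple.N, Mackey.T_R]
  rfl

theorem act_R {W X : FinGSet G} (f : W →[G] X) (z : MTriple M X) :
    act (GBispan.R f) (mk z) = mk (MTriple.R f z) :=
  ofBispan_congr (GBispan.comp_R (GBispan.T z.u) f) z.m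

/-! ### Finite products -/

/-- The disjoint union `A[M](X) × A[M](Y) → A[M](X ⊔ Y)` on isomorphism classes. -/
def pair {X Y : FinGSet G} : AM M X → AM M Y → AM M (X.sum Y) :=
  Quotient.lift₂ (fun z z' => mk (MTriple.pair z z')) <| by
    rintro z₁ z₂ z₁' z₂' ⟨e₁, he₁, hu₁, hm₁⟩ ⟨e₂, he₂, hu₂, hm₂⟩
    refine mk_eq ⟨FinGSet.sumMap e₁ e₂, Sum.map_bijective.2 ⟨he₁, he₂⟩, ?_, ?_⟩
    · refine MulActionHom.ext ?_
      rintro (a | a)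
      · exact congrArg Sum.inl (DFunLike.congr_fun hu₁ a)
      · exact congrArg Sum.inr (DFunLike.congr_fun hu₂ a)
    · refine Mackey.ext_sum ?_ ?_
      · rw [← Mackey.R_comp, Mackey.R_inl_pair, ← hm₁]
        exact (Mackey.R_comp M e₁ (FinGSet.inl _ _) _).trans
          (congrArg _ (Mackey.R_inl_pair z₁'.m z₂'.m))
      · rw [← Mackey.R_comp, Mackey.R_inr_pair, ← hm₂]
        exact (Mackey.R_comp M e₂ (FinGSet.inr _ _) _).trans
          (congrArg _ (Mackey.R_inr_pair z₁'.m z₂'.m))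

theorem act_R_inl_pair {X Y : FinGSet G} (x : AM M X) (y : AM M Y) :
    act (GBispan.R (FinGSet.inl X Y)) (pair x y) = x := by
  obtain ⟨z⟩ := x
  obtain ⟨z'⟩ := y
  refine (act_R _ _).trans (mk_eq ?_)
  refine (MTriple.isIso_equivalence M X).symm ⟨{
    toFun := fun a => (⟨Sum.inl a, z.u a, rfl⟩ :
      FinGSet.Pullback (FinGSet.sumMap z.u z'.u) (FinGSet.inl X Y))
    map_smul' := fun g a => FinGSet.Pullback.ext rfl (map_smul z.u g a) },
    FinGSet.bijective_pullback_inl _ _, rfl, ?_⟩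
  refine (Mackey.R_comp M _ _ _).symm.trans ?_
  exact Mackey.R_inl_pair z.m z'.m

theorem act_R_inr_pair {X Y : FinGSet G} (x : AM M X) (y : AM M Y) :
    act (GBispan.R (FinGSet.inr X Y)) (pair x y) = y := by
  obtain ⟨z⟩ := x
  obtain ⟨z'⟩ := y
  refine (act_R _ _).trans (mk_eq ?_)
  refine (MTriple.isIso_equivalence M Y).symm ⟨{
    toFun := fun a => (⟨Sum.inr a, z'.u a, rfl⟩ :
      FinGSet.Pullback (FinGSet.sumMap z.u z'.u) (FinGSet.inr X Y))
    map_smul' := fun g a => FinGSet.Pullback.ext rfl (map_smul z'.u g a) },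
    FinGSet.bijective_pullback_inr _ _, rfl, ?_⟩
  refine (Mackey.R_comp M _ _ _).symm.trans ?_
  exact Mackey.R_inr_pair z.m z'.m

/-- Every `G`-set over `X ⊔ Y` is the disjoint union of its restrictions to `X` and `Y`. -/
theorem pair_eta {X Y : FinGSet G} (x : AM M (X.sum Y)) :
    pair (act (GBispan.R (FinGSet.inl X Y)) x) (act (GBispan.R (FinGSet.inr X Y)) x) = x := by
  obtain ⟨z⟩ := x
  refine (congrArg₂ pair (act_R _ z) (act_R _ z)).trans (mk_eq ?_)
  refine ⟨FinGSet.sumElim (FinGSet.pullback.fst z.u (FinGSet.inl X Y))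
    (FinGSet.pullback.fst z.u (FinGSet.inr X Y)), FinGSet.bijective_sumElim z.u, ?_, ?_⟩
  · refine MulActionHom.ext ?_
    rintro (a | a)
    · exact FinGSet.Pullback.w a
    · exact FinGSet.Pullback.w a
  · refine Mackey.ext_sum ?_ ?_
    · exact (Mackey.R_comp M _ _ _).symm.trans (Mackey.R_inl_pair (M := M) _ _).symm
    · exact (Mackey.R_comp M _ _ _).symm.trans (Mackey.R_inr_pair (M := M) _ _).symm

/-- Restriction to the two summands is a bijection `A[M](X ⊔ Y) ≃ A[M](X) × A[M](Y)`. -/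
def sumEquiv (X Y : FinGSet G) : AM M (X.sum Y) ≃ AM M X × AM M Y where
  toFun x := (act (GBispan.R (FinGSet.inl X Y)) x, act (GBispan.R (FinGSet.inr X Y)) x)
  invFun p := pair p.1 p.2
  left_inv := pair_eta
  right_inv p := Prod.ext (act_R_inl_pair p.1 p.2) (act_R_inr_pair p.1 p.2)

/-- A triple over the empty set has empty underlying set `U`, and `M(∅)` is a point. -/
instance : Unique (AM M (FinGSet.empty G)) where
  default := mk ⟨FinGSet.empty G, .id G, default⟩
  uniq := by
    rintro ⟨z⟩
    have : IsEmpty z.U := Function.isEmpty z.u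
    exact (mk_eq ⟨FinGSet.emptyElim z.U, ⟨fun a => isEmptyElim a, fun a => isEmptyElim a⟩,
      MulActionHom.ext fun a => isEmptyElim a, Subsingleton.elim _ _⟩).symm

/-! ### Smallness -/

/-- A finite `G`-set is determined up to isomorphism by an action of `G` on some `Fin n`, and
since `G` is finite there are countably many of these; so `A[M](X)` is no larger than the
sets `M(U)`. -/
instance [Finite G] (M : Mackey.{u, w} G) (X : FinGSet G) : Small.{w} (AM M X) := by
  let F (n : ℕ) (a : MulAction G (ULift.{u} (Fin n))) : FinGSet G :=
    { carrier := ULift (Fin n), action := a }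
  have (n : ℕ) : Small.{w} (MulAction G (ULift.{u} (Fin n))) := by
    have : Finite (MulAction G (ULift.{u} (Fin n))) :=
      Finite.of_injective (β := G → ULift.{u} (Fin n) → ULift.{u} (Fin n))
        (fun a g x => a.smul g x) fun a b h =>
          MulAction.ext (funext fun g => funext fun x => congrFun (congrFun h g) x)
    infer_instance
  have (n : ℕ) (a : MulAction G (ULift.{u} (Fin n))) : Small.{w} (F n a →[G] X) := by
    have : Finite (F n a →[G] X) := DFunLike.finite _
    infer_instance
  refine small_of_surjective (α := Σ (n : ℕ) (a : MulAction G (ULift.{u} (Fin n)))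
    (_ : F n a →[G] X), Mackey.val M (F n a)) (f := fun t => mk ⟨F t.1 t.2.1, t.2.2.1, t.2.2.2⟩) ?_
  rintro ⟨z⟩
  obtain ⟨n, ⟨e⟩⟩ := Finite.exists_equiv_fin z.U
  let e' : ULift.{u} (Fin n) ≃ z.U := Equiv.ulift.trans e.symm
  let a : MulAction G (ULift.{u} (Fin n)) := e'.mulAction G
  let i : F n a →[G] z.U :=
    { toFun := e', map_smul' := fun g x => e'.apply_symm_apply _ }
  exact ⟨⟨n, a, z.u.comp i, Mackey.R M i z.m⟩, mk_eq ⟨i, e'.bijective, rfl, rfl⟩⟩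

end AM

/-! ### The functor `A[-]` and the adjunction -/

namespace Tambara

variable {G : Type u} [Group G]

/-- A functor on the bispan category preserves finite products if it sends the empty `G`-set to a
point and binary disjoint unions to products. -/
theorem preservesFiniteProducts_of_bijective (F : BispanCat G ⥤ Type w)
    (h₀ : Nonempty (Unique (F.obj (BispanCat.of (FinGSet.empty G)))))
    (h : ∀ X Y : FinGSet G, Function.Bijective fun x : F.obj (BispanCat.of (X.sum Y)) =>
      (F.map (GBispan.R (FinGSet.inl X Y)).hom x, F.map (GBispan.R (FinGSet.inr X Y)).hom x)) :
    PreservesFiniteProducts F := by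
  obtain ⟨h₀⟩ := h₀
  have h₁ : PreservesLimit (Functor.empty.{0} (BispanCat G)) F :=
    preservesLimit_of_preserves_limit_cone BispanCat.isTerminalEmpty
      ((isLimitMapConeEmptyConeEquiv _ _).symm ((Types.isTerminalEquivUnique _).symm h₀))
  have : PreservesLimitsOfShape (Discrete.{0} PEmpty) F :=
    preservesLimitsOfShape_pempty_of_preservesTerminal _
  have : PreservesLimitsOfShape (Discrete WalkingPair) F := by
    constructor
    intro K
    have : PreservesLimit (Limits.pair (K.obj ⟨WalkingPair.left⟩) (K.obj ⟨WalkingPair.right⟩)) F :=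
      preservesLimit_of_preserves_limit_cone (BispanCat.isLimitSum _ _)
        ((isLimitMapConeBinaryFanEquiv _ _ _).symm (IsLimit.ofIsoLimit
          (Types.binaryProductLimit _ _)
          (BinaryFan.ext (Equiv.ofBijective _ (h _ _)).toIso rfl rfl).symm))
    exact preservesLimit_of_iso_diagram _ (diagramIsoPair K).symm
  exact .of_preserves_binary_and_terminal _

end Tambara

namespace AM

variable {G : Type u} [Group G]

/-- The map `A[M](X) → A[M'](X)` induced by a morphism of Mackey functors. -/
def map {M M' : Mackey.{u, w} G} (φ : M ⟶ M') {X : FinGSet G} : AM M X → AM M' X :=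
  Quotient.map (MTriple.map φ) <| by
    rintro z z' ⟨e, he, hu, hm⟩
    exact ⟨e, he, hu, (Mackey.app_R φ e z'.m).symm.trans (congrArg _ hm)⟩

theorem map_ofBispan {M M' : Mackey.{u, w} G} (φ : M ⟶ M') {X Y : FinGSet G} (ω : GBispan X Y)
    (m : Mackey.val M X) : map φ (ofBispan ω m) = ofBispan ω (Mackey.app φ X m) :=
  congrArg (fun n => mk ⟨ω.B, ω.r, n⟩) (Mackey.app_map φ ω.span m)

theorem map_act {M M' : Mackey.{u, w} G} (φ : M ⟶ M') {X Y : FinGSet G} (ω : GBispan X Y)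
    (x : AM M X) : map φ (act ω x) = act ω (map φ x) := by
  obtain ⟨z⟩ := x
  exact map_ofBispan φ _ z.m

theorem map_id (M : Mackey.{u, w} G) {X : FinGSet G} (x : AM M X) : map (𝟙 M) x = x := by
  obtain ⟨z⟩ := x
  rfl

theorem map_comp {M M' M'' : Mackey.{u, w} G} (φ : M ⟶ M') (ψ : M' ⟶ M'') {X : FinGSet G}
    (x : AM M X) : map (φ ≫ ψ) x = map ψ (map φ x) := by
  obtain ⟨z⟩ := x
  rfl

/-- The evaluation `[W, f, m] ↦ T_f m` of a class with coefficients in a Tambara functor. -/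
def eval (S : Tambara.{u, w} G) {X : FinGSet G} : AM ((Tambara.U G).obj S) X → Tambara.val S X :=
  Quotient.lift (fun z => Tambara.T S z.u z.m) <| by
    rintro z z' ⟨e, he, hu, hm⟩
    rw [← hu, ← hm]
    exact (Tambara.map_comp S _ _ z'.m).symm.trans
      (Tambara.map_congr S (GBispan.R_comp_T_of_bijective e he z'.u) z'.m)

/-- Since `T_r N_q R_p` is the action of the bispan, evaluation sends the class `[ω; s]` to
`ω` applied to `s`. Equivariance of the counit under all bispans follows. -/
theorem eval_ofBispan (S : Tambara.{u, w} G) {X Y : FinGSet G} (ω : GBispan X Y)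
    (s : Tambara.val S X) :
    eval S (ofBispan (M := (Tambara.U G).obj S) ω s) = Tambara.map S ω s :=
  (Tambara.map_comp S ω.span.toBispan (GBispan.T ω.r) s).symm.trans
    (Tambara.map_congr S (GBispan.span_comp_T ω) s)

theorem eval_act (S : Tambara.{u, w} G) {X Y : FinGSet G} (ω : GBispan X Y)
    (x : AM ((Tambara.U G).obj S) X) : eval S (act ω x) = Tambara.map S ω (eval S x) := by
  obtain ⟨z⟩ := x
  exact (eval_ofBispan S _ z.m).trans (Tambara.map_comp S _ _ _)

theorem eval_map {S S' : Tambara.{u, w} G} (φ : S ⟶ S') {X : FinGSet G}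
    (x : AM ((Tambara.U G).obj S) X) :
    eval S' (map ((Tambara.U G).map φ) x) = Tambara.app φ X (eval S x) := by
  obtain ⟨z⟩ := x
  exact (Tambara.app_map φ (GBispan.T z.u) z.m).symm

/-- The map `m ↦ [X, 1, m]` commutes with spans when a span acts on `A[M]` as a bispan with
trivial last leg, so that the transfers of `M` become norms of `A[M]`. -/
theorem mk_unit_map {M : Mackey.{u, w} G} {X Y : FinGSet G} (σ : GSpan X Y)
    (m : Mackey.val M X) :
    mk (MTriple.unit (Mackey.map M σ m)) = act σ.toBispan (mk (MTriple.unit m)) := by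
  refine (ofBispan_T (.id G) _).symm.trans ((ofBispan_toBispan_comp σ _ m).symm.trans ?_)
  exact ofBispan_congr ((GBispan.isIso_equivalence X Y).trans (GBispan.comp_one _)
    ((GBispan.isIso_equivalence X Y).symm (GBispan.one_comp _))) m

/-- The action of a morphism of the bispan category on `A[M]`. -/
def actHom (M : Mackey.{u, w} G) {X Y : FinGSet G} (f : BispanCat.of X ⟶ BispanCat.of Y)
    (x : AM M X) : AM M Y :=
  Quotient.lift (fun ω : GBispan X Y => act ω x) (fun _ _ h => act_congr h x) f

theorem actHom_id (M : Mackey.{u, w} G) {X : FinGSet G} (x : AM M X) :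
    actHom M (𝟙 (BispanCat.of X)) x = x :=
  act_one x

theorem actHom_comp (M : Mackey.{u, w} G) {X Y Z : FinGSet G}
    (f : BispanCat.of X ⟶ BispanCat.of Y) (g : BispanCat.of Y ⟶ BispanCat.of Z) (x : AM M X) :
    actHom M (f ≫ g) x = actHom M g (actHom M f x) := by
  obtain ⟨ω⟩ := f
  obtain ⟨ω'⟩ := g
  exact act_comp ω ω' x

variable [Finite G]

/-- A copy of the set `A[M](X)` in the universe of the values of `M`. -/
def SmallCopy (M : Mackey.{u, w} G) (X : FinGSet G) : Type w := Shrink.{w} (AM M X)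

/-- The identification of `A[M](X)` with its small copy. -/
def shrinkEquiv (M : Mackey.{u, w} G) (X : FinGSet G) : AM M X ≃ SmallCopy M X :=
  equivShrink (AM M X)

/-- The Tambara functor `A[M]`. Its values are small copies of the sets
`A[M](X)`. -/
def tambara (M : Mackey.{u, w} G) : Tambara.{u, w} G where
  obj :=
    { obj X := SmallCopy M X
      map {X Y} f := ↾fun x => shrinkEquiv M Y (actHom M f ((shrinkEquiv M X).symm x))
      map_id X := ConcreteCategory.hom_ext _ _ fun x =>
        (congrArg (shrinkEquiv M X) (actHom_id M _)).trans (Equiv.apply_symm_apply _ x)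
      map_comp {X Y Z} f g := ConcreteCategory.hom_ext _ _ fun x =>
        congrArg (shrinkEquiv M Z) ((actHom_comp M f g _).trans
          (congrArg (actHom M g) (Equiv.symm_apply_apply (shrinkEquiv M Y) _).symm)) }
  property := by
    refine Tambara.preservesFiniteProducts_of_bijective _
      ⟨(shrinkEquiv M (FinGSet.empty G)).symm.unique⟩ fun X Y => ?_
    exact (((shrinkEquiv M (X.sum Y)).symm.trans (sumEquiv X Y)).trans
      ((shrinkEquiv M X).prodCongr (shrinkEquiv M Y))).bijective

/-- The identification of `A[M](X)` with the value at `X` of the Tambara functor. -/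
def equiv (M : Mackey.{u, w} G) (X : FinGSet G) : AM M X ≃ Tambara.val (tambara M) X :=
  shrinkEquiv M X

theorem tambara_map (M : Mackey.{u, w} G) {X Y : FinGSet G} (ω : GBispan X Y) (x : AM M X) :
    Tambara.map (tambara M) ω (equiv M X x) = equiv M Y (act ω x) :=
  congrArg (fun x => equiv M Y (act ω x)) ((equiv M X).symm_apply_apply x)

/-- The maps induced by `φ` commute with the action of bispans on the small copies. -/
theorem naturality {M M' : Mackey.{u, w} G} (φ : M ⟶ M') {X Y : FinGSet G} (ω : GBispan X Y)
    (x : Tambara.val (tambara M) X) :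
    equiv M' Y (map φ ((equiv M Y).symm (Tambara.map (tambara M) ω x))) =
      Tambara.map (tambara M') ω (equiv M' X (map φ ((equiv M X).symm x))) := by
  obtain ⟨x, rfl⟩ := (equiv M X).surjective x
  rw [tambara_map, tambara_map, Equiv.symm_apply_apply, Equiv.symm_apply_apply, map_act]

/-- The functor `M ↦ A[M]`. -/
def functor (G : Type u) [Group G] [Finite G] : Mackey.{u, w} G ⥤ Tambara.{u, w} G where
  obj := tambara
  map {M M'} φ := ObjectProperty.homMk
    { app := fun X => ↾fun x => equiv M' X (map φ ((equiv M X).symm x))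
      naturality := by
        rintro X Y ⟨ω⟩
        exact ConcreteCategory.hom_ext _ _ fun x => naturality φ ω x }
  map_id M := by
    refine ObjectProperty.hom_ext _ (NatTrans.ext (funext fun X =>
      ConcreteCategory.hom_ext _ _ fun x => ?_))
    exact (congrArg _ (map_id M _)).trans (Equiv.apply_symm_apply _ x)
  map_comp {M M' M''} φ ψ := by
    refine ObjectProperty.hom_ext _ (NatTrans.ext (funext fun X =>
      ConcreteCategory.hom_ext _ _ fun x => ?_))
    refine congrArg (equiv M'' X) ((map_comp φ ψ _).trans ?_)
    exact congrArg (map ψ) (Equiv.symm_apply_apply _ _).symm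

theorem functor_map {M M' : Mackey.{u, w} G} (φ : M ⟶ M') {X : FinGSet G} (x : AM M X) :
    Tambara.app ((functor G).map φ) X (equiv M X x) = equiv M' X (map φ x) :=
  congrArg (fun x => equiv M' X (map φ x)) ((equiv M X).symm_apply_apply x)

/-- The unit `m ↦ [X, 1, m]`. -/
def unit (G : Type u) [Group G] [Finite G] :
    𝟭 (Mackey.{u, w} G) ⟶ functor G ⋙ Tambara.U G where
  app M := ObjectProperty.homMk
    { app := fun X => ↾fun m => equiv M X (mk (MTriple.unit (X := X) m))
      naturality := by
        rintro X Y ⟨σ⟩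
        refine ConcreteCategory.hom_ext _ _ fun m => ?_
        exact (congrArg (equiv M Y) (mk_unit_map (M := M) σ m)).trans
          (tambara_map M σ.toBispan _).symm }
  naturality M M' φ := by
    refine ObjectProperty.hom_ext _ (NatTrans.ext (funext fun X =>
      ConcreteCategory.hom_ext _ _ fun m => ?_))
    exact (functor_map φ (mk (MTriple.unit (X := X) m))).symm

/-- The counit `[W, f, m] ↦ T_f m`. -/
def counit (G : Type u) [Group G] [Finite G] :
    Tambara.U G ⋙ functor G ⟶ 𝟭 (Tambara.{u, w} G) where
  app S := ObjectProperty.homMk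
    { app := fun X => ↾fun x => eval S ((equiv ((Tambara.U G).obj S) X).symm x)
      naturality := by
        rintro X Y ⟨ω⟩
        refine ConcreteCategory.hom_ext _ _ fun x => ?_
        refine Eq.trans (congrArg (eval S) (Equiv.symm_apply_apply _ _)) ?_
        exact eval_act S ω _ }
  naturality S S' φ := by
    refine ObjectProperty.hom_ext _ (NatTrans.ext (funext fun X =>
      ConcreteCategory.hom_ext _ _ fun x => ?_))
    refine Eq.trans (congrArg (eval S') (Equiv.symm_apply_apply _ _)) ?_
    exact eval_map φ _

theorem counit_app (S : Tambara.{u, w} G) {X : FinGSet G} (x : AM ((Tambara.U G).obj S) X) :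
    Tambara.app ((counit G).app S) X (equiv ((Tambara.U G).obj S) X x) = eval S x :=
  congrArg (eval S) ((equiv _ X).symm_apply_apply x)

/-- The composite sends `[U, u, m]` first to `[U, u, [U, 1, m]]` and then to
`T_u [U, 1, m] = [U, u, m]`. -/
theorem left_triangle (M : Mackey.{u, w} G) {X : FinGSet G} (x : Tambara.val (tambara M) X) :
    Tambara.app ((counit G).app (tambara M)) X
      (Tambara.app ((functor G).map ((unit G).app M)) X x) = x := by
  obtain ⟨⟨z⟩, rfl⟩ := (equiv M X).surjective x
  refine (congrArg _ (functor_map ((unit G).app M) (mk z))).trans ?_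
  refine (counit_app (tambara M) (map ((unit G).app M) (mk z))).trans ?_
  refine (tambara_map M (GBispan.T z.u) (mk (MTriple.unit z.m))).trans ?_
  exact congrArg _ (act_T z.u (MTriple.unit z.m))

/-- The adjunction `A[-] ⊣ U` with unit `m ↦ [X, 1, m]` and counit `[W, f, m] ↦ T_f m`. -/
def adjunction (G : Type u) [Group G] [Finite G] : functor.{u, w} G ⊣ Tambara.U G where
  unit := unit G
  counit := counit G
  left_triangle_components M := by
    refine ObjectProperty.hom_ext _ (NatTrans.ext (funext fun X =>
      ConcreteCategory.hom_ext _ _ fun x => ?_))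
    exact left_triangle M x
  right_triangle_components S := by
    refine ObjectProperty.hom_ext _ (NatTrans.ext (funext fun X =>
      ConcreteCategory.hom_ext _ _ fun s => ?_))
    exact (counit_app S (mk (MTriple.unit (M := (Tambara.U G).obj S) (X := X) s))).trans
      (Tambara.map_one S (X := X) s)

end AM

end

theorem mainTheorem8 (G : Type u) [Group G] [Finite G] :
    ∃ (A : Mackey.{u, w} G ⥤ Tambara.{u, w} G)
      (e : ∀ (M : Mackey.{u, w} G) (X : FinGSet G), AM M X ≃ Tambara.val (A.obj M) X)
      (adj : A ⊣ Tambara.U.{u, w} G),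
      -- the operations of the Tambara functor `A[M]`
      (∀ (M : Mackey.{u, w} G) (X Y : FinGSet G) (g : X →[G] Y) (z : MTriple M X),
        Tambara.T (A.obj M) g (e M X (AM.mk z)) = e M Y (AM.mk (MTriple.T g z))) ∧
      (∀ (M : Mackey.{u, w} G) (X Y : FinGSet G) (g : X →[G] Y) (z : MTriple M X),
        Tambara.N (A.obj M) g (e M X (AM.mk z)) = e M Y (AM.mk (MTriple.N g z))) ∧
      (∀ (M : Mackey.{u, w} G) (W X : FinGSet G) (f : W →[G] X) (z : MTriple M X),
        Tambara.R (A.obj M) f (e M X (AM.mk z)) = e M W (AM.mk (MTriple.R f z))) ∧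
      -- the effect of the functor `A[-]` on morphisms
      (∀ (M M' : Mackey.{u, w} G) (φ : M ⟶ M') (X : FinGSet G) (z : MTriple M X),
        Tambara.app (A.map φ) X (e M X (AM.mk z)) = e M' X (AM.mk (MTriple.map φ z))) ∧
      -- the unit `m ↦ [X, 1, m]`
      (∀ (M : Mackey.{u, w} G) (X : FinGSet G) (m : Mackey.val M X),
        Mackey.app (adj.unit.app M) X m = e M X (AM.mk (MTriple.unit m))) ∧
      -- the counit `[W, f, m] ↦ T_f m`
      (∀ (S : Tambara.{u, w} G) (X : FinGSet G) (z : MTriple ((Tambara.U.{u, w} G).obj S) X),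
        Tambara.app (adj.counit.app S) X (e ((Tambara.U.{u, w} G).obj S) X (AM.mk z)) =
          Tambara.T S z.u z.m) := by
  exact ⟨AM.functor G, AM.equiv, AM.adjunction G,
    fun M X Y g z => (AM.tambara_map M (GBispan.T g) (AM.mk z)).trans
      (congrArg _ (AM.act_T g z)),
    fun M X Y g z => (AM.tambara_map M (GBispan.N g) (AM.mk z)).trans
      (congrArg _ (AM.act_N g z)),
    fun M W X f z => (AM.tambara_map M (GBispan.R f) (AM.mk z)).trans
      (congrArg _ (AM.act_R f z)),
    fun M M' φ X z => AM.functor_map φ (AM.mk z),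
    fun M X m => rfl,
    fun S X z => AM.counit_app S (AM.mk z)⟩
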